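/- Let $n\ge 1$ and $s\in(0,\tfrac12)$. Let $P^s(z,t)$, $z\in\mathbb R^n$, $t>0$, be the fundamental solution of the fractional heat equation $\partial_t v+(-\Delta)^s v=0$ on $\mathbb R^n$, that is, $$P^s(z,t)=\frac1{(2\pi)^n}\int_{\mathbb R^n}e^{i\langle z,\xi\rangle}e^{-t|\xi|^{2s}}\,d\xi .$$ For a Lebesgue measurable set $E\subset\mathbb R^n$ with complement $E^c$ define, with values in $[0,+\infty]$, $$\mathcal E^s_t(E)=\int_E\int_{E^c}P^s(x-y,t)\,dy\,dx,\qquad \mathrm P_{2s}(E)=\int_E\int_{E^c}\frac{1}{|x-y|^{n+2s}}\,dy\,dx,$$ and let $$C_{n,s}=\left(\int_{\mathbb R^n}\frac{1-\cos(h_1)}{|h|^{n+2s}}\,dh\right)^{-1}.$$ Let $(t_i)_{i\in\mathbb N}\subset(0,1)$ be a sequence with $t_i\to0^+$. Then $\mathcal E^s_{t_i}/t_i$ $\Gamma$-converges to $C_{n,s}\,\mathrm P_{2s}$ with respect to the $L^1(\mathbb R^n)$-convergence of characteristic functions, and the constant sequences are recovery sequences: (i) (Lower bound) for every Lebesgue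 measurable $E\subset\mathbb R^n$ and every sequence of Lebesgue measurable sets $E_i\subset\mathbb R^n$ with $\|\chi_{E_i}-\chi_E\|_{L^1(\mathbb R^n)}\to0$, $$C_{n,s}\,\mathrm P_{2s}(E)\le\liminf_{i\to\infty}\frac{\mathcal E^s_{t_i}(E_i)}{t_i};$$ (ii) (Upper bound) for every Lebesgue measurable $E\subset\mathbb R^n$ there are Lebesgue measurable sets $E_i\subset\mathbb R^n$ with $\|\chi_{E_i}-\chi_E\|_{L^1(\mathbb R^n)}\to0$ and $$\limsup_{i\to\infty}\frac{\mathcal E^s_{t_i}(E_i)}{t_i}\le C_{n,s}\,\mathrm P_{2s}(E);$$ (iii) (Pointwise convergence) for every Lebesgue measurable $E\subset\mathbb R^n$, $$\lim_{i\to\infty}\frac{\mathcal E^s_{t_i}(E)}{t_i}=C_{n,s}\,\mathrm P_{2s}(E)\quad\text{in }[0,+\infty],$$ so that in (ii) one may take $E_i=E$ for all $i$. -/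

import Mathlib

open Filter Topology MeasureTheory

noncomputable section

/-- The fractional heat kernel `P^s(z, t)` of `ℝⁿ`, i.e. the fundamental solution of
`∂ₜ v + (-Δ)^s v = 0`. It is given by Fourier inversion from
`(2π)^(-n/2) ∫ P^s(z, t) e^{-i⟨z, ξ⟩} dz = (2π)^(-n/2) e^{-t|ξ|^{2s}}`, that is
`P^s(z, t) = (2π)^(-n) ∫ e^{i⟨z, ξ⟩} e^{-t|ξ|^{2s}} dξ`
(the integral is absolutely convergent and real for `s, t > 0`). -/
def fracHeatKernel {n : ℕ} (s : ℝ) (z : EuclideanSpace ℝ (Fin n)) (t : ℝ) : ℝ :=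
  ((2 * Real.pi) ^ n)⁻¹ *
    (∫ ξ : EuclideanSpace ℝ (Fin n),
      Complex.exp (Complex.I * ((inner ℝ z ξ : ℝ) : ℂ)) *
        ((Real.exp (-t * ‖ξ‖ ^ (2 * s)) : ℝ) : ℂ)).re

/-- The energy `ℰ_t^s(E) = ∫_E ∫_{Eᶜ} P^s(x - y, t) dy dx`, with values in `[0, ∞]`
(the kernel `P^s` is nonnegative for `0 < s < 1`). -/
def fracHeatEnergy {n : ℕ} (s t : ℝ) (E : Set (EuclideanSpace ℝ (Fin n))) : ENNReal :=
  ∫⁻ x in E, ∫⁻ y in Eᶜ, ENNReal.ofReal (fracHeatKernel s (x - y) t)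

/-- The `2s`-fractional perimeter `P_{2s}(E) = ∫_E ∫_{Eᶜ} |x - y|^{-(n + 2s)} dy dx`,
with values in `[0, ∞]`. -/
def fracPerimeter {n : ℕ} (s : ℝ) (E : Set (EuclideanSpace ℝ (Fin n))) : ENNReal :=
  ∫⁻ x in E, ∫⁻ y in Eᶜ, ENNReal.ofReal (1 / ‖x - y‖ ^ ((n : ℝ) + 2 * s))

/-- The constant `C_{n,s} = (∫ (1 - cos h₁) / |h|^{n + 2s} dh)⁻¹`; the integral runs over `ℝⁿ`,
`n ≥ 1`, and `h₁` is the first coordinate of `h`. -/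
def fracLaplaceConst (n : ℕ) [NeZero n] (s : ℝ) : ℝ :=
  (∫ h : EuclideanSpace ℝ (Fin n), (1 - Real.cos (h 0)) / ‖h‖ ^ ((n : ℝ) + 2 * s))⁻¹

/-- Strong `L¹` convergence of characteristic functions: `‖χ_{F i} - χ_E‖_{L¹(ℝⁿ)} → 0`. -/
def TendstoSetL1 {n : ℕ} (F : ℕ → Set (EuclideanSpace ℝ (Fin n)))
    (E : Set (EuclideanSpace ℝ (Fin n))) : Prop :=
  Tendsto
    (fun i => eLpNorm
      (fun x => (F i).indicator (fun _ => (1 : ℝ)) x - E.indicator (fun _ => (1 : ℝ)) x)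
      1 volume)
    atTop (𝓝 0)

end

/-!
The statement reduces to two facts about the kernel. For every `z ≠ 0`,
`P^s(z, t) / t ≤ C_{n,s} / |z|^(n + 2s)` for all `t > 0` (`fracHeatKernel_div_le`), and equality
holds in the limit `t → 0⁺` (`tendsto_fracHeatKernel_div`). Since `x - y ≠ 0` for `x ∈ E` and
`y ∉ E`, these give convergence of the energies of a fixed set: the upper bound by monotonicity, the
lower bound by Fatou's lemma (`tendsto_kernelEnergy`). Fatou's lemma also gives the lower bound for
varying sets, along a subsequence which realises the lower limit and converges almost everywhere
(`kernelEnergy_le_liminf`). Finiteness of the perimeter plays no role.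

The kernel is handled by subordination. Let `η` be the function with Laplace transform
`exp (-λ^s)`, i.e. the one-sided stable density. Then off the origin `P^s(z, t)` is the average of
the Gaussian heat kernels `G(z, t^(1/s) u)` against `η(u) du`
(`fracHeatKernel_eq_integral_gaussKernel`), so that, after a substitution,
`P^s(z, t) / t = ∫ θ(v / t^(1/s)) v^(-1-s) G(z, v) dv` with `θ(u) = u^(1+s) η(u)`.
Both facts then follow from `|θ| ≤ κ` and `θ(u) → κ` as `u → ∞`, with
`κ = sin(πs) Γ(1+s) / π`, because `κ ∫ v^(-1-s) G(z, v) dv` is a multiple of `|z|^(-n-2s)`.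

The density `η` is *defined* as `π⁻¹ ∫ e^(-ur) e^(-r^s cos πs) sin(r^s sin πs) dr`, from which the
bound and the limit of `θ` are immediate; here `s < 1/2` enters, through `cos πs > 0`. Its Laplace
transform is computed from the Stieltjes representation of `exp (-λ^s)`
(`integral_stableJump_div`), which is Cauchy's formula for the plane slit along the negative axis,
carried out in the strip `|Im w| ≤ π` with `z = exp w`.

The multiple of `|z|^(-n-2s)` is `C_{n,s}` (`fracLaplaceConst_eq`): integrating the Gaussian
superposition against `1 - cos h₁` gives `κ ∫ v^(-1-s) (1 - e^(-v)) dv = κ Γ(1-s) / s = 1` by the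
reflection formula.
-/

/-! ### Stieltjes representation of the stretched exponential -/

theorem norm_cexp_neg_cexp (s : ℝ) (w : ℂ) :
    ‖Complex.exp (-Complex.exp (s * w))‖ =
      Real.exp (-(Real.exp (s * w.re) * Real.cos (s * w.im))) := by
  rw [Complex.norm_exp, Complex.neg_re, Complex.exp_re]
  simp

theorem cos_mul_pos_of_abs_le_pi {s y : ℝ} (hs0 : 0 < s) (hs : s < 1 / 2) (hy : |y| ≤ Real.pi) :
    0 < Real.cos (s * y) := by
  have h := abs_le.1 hy
  have hpi := Real.pi_pos
  apply Real.cos_pos_of_mem_Ioo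
  constructor <;> nlinarith

theorem norm_cexp_neg_cexp_le_one {s : ℝ} (hs0 : 0 < s) (hs : s < 1 / 2) {w : ℂ}
    (hw : |w.im| ≤ Real.pi) : ‖Complex.exp (-Complex.exp (s * w))‖ ≤ 1 := by
  rw [norm_cexp_neg_cexp, Real.exp_le_one_iff]
  have := cos_mul_pos_of_abs_le_pi hs0 hs hw
  have := Real.exp_pos (s * w.re)
  nlinarith

/-- The boundary density of `exp (-z ^ s)` along its cut, the negative real axis: `-1` times the
imaginary part of its boundary value at `-r` from above. -/
noncomputable def stableJump (s r : ℝ) : ℝ :=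
  Real.exp (-(Real.cos (Real.pi * s) * r ^ s)) * Real.sin (Real.sin (Real.pi * s) * r ^ s)

/-- The integrand of the Cauchy formula for `exp (-z ^ s)` at the point `exp a`, in the logarithmic
coordinate `z = exp w`, after subtraction of the value at the pole. -/
noncomputable def stripIntegrand (s a : ℝ) (w : ℂ) : ℂ :=
  dslope (fun w : ℂ => Complex.exp (-Complex.exp (s * w))) a w / dslope Complex.exp a w *
    Complex.exp w

theorem stripIntegrand_of_ne (s a : ℝ) {w : ℂ} (hw : w ≠ a) :
    stripIntegrand s a w =
      (Complex.exp (-Complex.exp (s * w)) - Complex.exp (-Complex.exp (s * a))) /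
        (Complex.exp w - Complex.exp a) * Complex.exp w := by
  have hwa : w - a ≠ 0 := sub_ne_zero.2 hw
  rw [stripIntegrand, dslope_of_ne _ hw, dslope_of_ne _ hw, slope_def_field, slope_def_field,
    div_div_div_cancel_right₀ hwa]

theorem differentiable_dslope_of_differentiable {f : ℂ → ℂ} (hf : Differentiable ℂ f) (a : ℂ) :
    Differentiable ℂ (dslope f a) := by
  rw [← differentiableOn_univ] at hf ⊢
  exact (Complex.differentiableOn_dslope univ_mem).2 hf

theorem differentiable_cexp_neg_cexp (s : ℝ) :
    Differentiable ℂ (fun w : ℂ => Complex.exp (-Complex.exp (s * w))) := by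
  fun_prop

theorem dslope_cexp_ne_zero (a : ℝ) {w : ℂ} (hw : |w.im| ≤ Real.pi) :
    dslope Complex.exp a w ≠ 0 := by
  by_cases h : w = a
  · rw [h, dslope_same, Complex.deriv_exp]
    exact Complex.exp_ne_zero _
  · rw [dslope_of_ne _ h, slope_def_field]
    refine div_ne_zero (sub_ne_zero.2 fun he => ?_) (sub_ne_zero.2 h)
    obtain ⟨k, hk⟩ := Complex.exp_eq_exp_iff_exists_int.1 he
    have him := congrArg Complex.im hk
    simp at him
    have hk0 : k = 0 := by
      by_contra hk0
      have h1 : (1 : ℝ) ≤ |(k : ℝ)| := by exact_mod_cast Int.one_le_abs hk0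
      rw [him, abs_mul, abs_of_pos Real.two_pi_pos] at hw
      nlinarith [Real.pi_pos]
    apply h
    rw [hk, hk0]
    simp

theorem measurable_stripIntegrand (s a : ℝ) : Measurable (stripIntegrand s a) := by
  unfold stripIntegrand
  have h1 := (differentiable_dslope_of_differentiable
    (differentiable_cexp_neg_cexp s) a).continuous.measurable
  have h2 := (differentiable_dslope_of_differentiable Complex.differentiable_exp
      a).continuous.measurable
  exact (h1.div h2).mul Complex.measurable_exp

theorem stripIntegrand_rect (s a R : ℝ) :
    (∫ x in -R..R, stripIntegrand s a (x + (-Real.pi : ℝ) * Complex.I)) -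
      (∫ x in -R..R, stripIntegrand s a (x + Real.pi * Complex.I)) +
      Complex.I • (∫ y in -Real.pi..Real.pi, stripIntegrand s a (R + y * Complex.I)) -
      Complex.I • (∫ y in -Real.pi..Real.pi, stripIntegrand s a ((-R : ℝ) + y * Complex.I)) =
          0 := by
  have := Complex.integral_boundary_rect_eq_zero_of_differentiableOn (stripIntegrand s a)
    ⟨-R, -Real.pi⟩ ⟨R, Real.pi⟩ ?_
  · exact this
  · intro w hw
    have hw2 : w.im ∈ Set.uIcc (-Real.pi) Real.pi := hw.2
    rw [Set.uIcc_of_le (by linarith [Real.pi_pos])] at hw2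
    apply DifferentiableAt.differentiableWithinAt
    have h1 := differentiable_dslope_of_differentiable (differentiable_cexp_neg_cexp s) a w
    have h2 := differentiable_dslope_of_differentiable Complex.differentiable_exp a w
    exact (h1.div h2 (dslope_cexp_ne_zero a (abs_le.2 hw2))).mul
        Complex.differentiable_exp.differentiableAt

theorem cexp_neg_cexp_pi (s x : ℝ) (ε : ℝ) :
    Complex.exp (-Complex.exp (s * (x + (ε * Real.pi : ℝ) * Complex.I))) =
      Complex.exp (-(Real.exp (s * x) * (Real.cos (s * (ε * Real.pi)) +
        Real.sin (s * (ε * Real.pi)) * Complex.I) : ℂ)) := by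
  rw [mul_add, Complex.exp_add, Complex.ofReal_exp]
  congr 3
  · push_cast; rfl
  · rw [← mul_assoc, ← Complex.ofReal_mul, Complex.exp_mul_I, Complex.ofReal_cos,
        Complex.ofReal_sin]

/-- The jump of the integrand across the strip, which is the Stieltjes kernel times
`stableJump`. -/
theorem stripIntegrand_jump (s a x : ℝ) :
    stripIntegrand s a (x + (-Real.pi : ℝ) * Complex.I) -
      stripIntegrand s a (x + Real.pi * Complex.I) =
      (2 * Complex.I) * ((stableJump s (Real.exp x) / (Real.exp x + Real.exp a) * Real.exp x : ℝ) :
          ℂ) := by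
  have hne : ∀ ε : ℝ, ε ≠ 0 → (x + (ε * Real.pi : ℝ) * Complex.I : ℂ) ≠ a := by
    intro ε hε h
    have := congrArg Complex.im h
    simp [hε, Real.pi_ne_zero] at this
  have hm := hne (-1) (by norm_num)
  have hp := hne 1 (by norm_num)
  have em : Complex.exp (x + ((-1 : ℝ) * Real.pi : ℝ) * Complex.I) = -(Real.exp x : ℝ) := by
    rw [Complex.exp_add, Complex.ofReal_exp]
    have : Complex.exp (((-1 : ℝ) * Real.pi : ℝ) * Complex.I) = -1 := by
      push_cast
      rw [neg_one_mul, neg_mul, Complex.exp_neg, Complex.exp_pi_mul_I]; norm_num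
    rw [this]; ring
  have ep : Complex.exp (x + ((1 : ℝ) * Real.pi : ℝ) * Complex.I) = -(Real.exp x : ℝ) := by
    rw [Complex.exp_add, Complex.ofReal_exp, one_mul, Complex.exp_pi_mul_I]; ring
  have h1 := stripIntegrand_of_ne s a hm
  have h2 := stripIntegrand_of_ne s a hp
  rw [em, cexp_neg_cexp_pi] at h1
  rw [ep, cexp_neg_cexp_pi] at h2
  rw [neg_one_mul] at h1
  rw [one_mul] at h2
  rw [h1, h2]
  have hd : (Real.exp x + Real.exp a : ℂ) ≠ 0 := by
    have : (Real.exp x + Real.exp a : ℝ) ≠ 0 := by positivity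
    exact_mod_cast this
  have hd' : (-(Real.exp x : ℂ) - Complex.exp a) ≠ 0 := by
    rw [← Complex.ofReal_exp]
    intro h
    apply hd
    linear_combination -h
  have key : Complex.exp (-(Real.exp (s * x) * (Real.cos (s * (-Real.pi)) +
        Real.sin (s * (-Real.pi)) * Complex.I) : ℂ)) -
      Complex.exp (-(Real.exp (s * x) * (Real.cos (s * Real.pi) +
        Real.sin (s * Real.pi) * Complex.I) : ℂ)) = 2 * Complex.I *
            (stableJump s (Real.exp x) : ℝ) := by
    have hpow : Real.exp x ^ s = Real.exp (s * x) := by rw [← Real.exp_mul, mul_comm]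
    rw [mul_neg, Real.cos_neg, Real.sin_neg, stableJump, hpow, mul_comm Real.pi s]
    generalize Real.cos (s * Real.pi) = c
    generalize Real.sin (s * Real.pi) = d
    generalize Real.exp (s * x) = e
    have e1 : (-(e * (c + (-d : ℝ) * Complex.I)) : ℂ) = ((-(c * e) : ℝ) : ℂ) +
        ((d * e : ℝ) : ℂ) * Complex.I := by
      push_cast; ring
    have e2 : (-(e * (c + d * Complex.I)) : ℂ) = ((-(c * e) : ℝ) : ℂ) +
        ((-(d * e) : ℝ) : ℂ) * Complex.I := by
      push_cast; ring
    rw [e1, e2, Complex.exp_add, Complex.exp_add, Complex.exp_mul_I, Complex.exp_mul_I]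
    rw [Complex.ofReal_mul (Real.exp _), Complex.ofReal_exp, Complex.ofReal_sin]
    rw [Complex.ofReal_neg (d * e), Complex.cos_neg, Complex.sin_neg]
    ring
  rw [div_mul_eq_mul_div, div_mul_eq_mul_div, ← sub_div, div_eq_iff hd', ← sub_mul,
    sub_sub_sub_cancel_right, key]
  push_cast
  rw [← Complex.ofReal_exp x, ← Complex.ofReal_exp a]
  field_simp
  ring

theorem tendsto_stripIntegrand_right (s a : ℝ) (hs0 : 0 < s) (hs : s < 1 / 2) :
    Tendsto (fun R : ℝ => ∫ y in -Real.pi..Real.pi, stripIntegrand s a (R + y * Complex.I)) atTop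
      (𝓝 (-(2 * Real.pi * Real.exp (-Real.exp (s * a)) : ℝ))) := by
  have hpi := Real.pi_pos
  have hlim : (∫ y in -Real.pi..Real.pi, (-(Real.exp (-Real.exp (s * a)) : ℝ) : ℂ)) =
      (-(2 * Real.pi * Real.exp (-Real.exp (s * a)) : ℝ) : ℂ) := by
    rw [intervalIntegral.integral_const, Complex.real_smul]; push_cast; ring
  rw [← hlim]
  have hform : ∀ R y : ℝ, a < R → stripIntegrand s a (R + y * Complex.I) =
      (Complex.exp (-Complex.exp (s * (R + y * Complex.I))) - Complex.exp (-Complex.exp (s * a))) /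
        (1 - Complex.exp (a - (R + y * Complex.I))) := by
    intro R y hR
    have hne : (R + y * Complex.I : ℂ) ≠ a := by
      intro h
      have := congrArg Complex.re h
      simp at this
      linarith
    rw [stripIntegrand_of_ne s a hne, Complex.exp_sub a]
    have := Complex.exp_ne_zero (R + y * Complex.I)
    rw [div_mul_eq_mul_div, one_sub_div this, div_div_eq_mul_div]
  have hn : ∀ R y : ℝ, ‖Complex.exp (a - (R + y * Complex.I))‖ = Real.exp (a - R) := by
    intro R y
    rw [Complex.norm_exp]; simp
  refine intervalIntegral.tendsto_integral_filter_of_dominated_convergence (fun _ => 4) ?_ ?_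
    intervalIntegrable_const ?_
  · refine Eventually.of_forall fun R => ?_
    exact ((measurable_stripIntegrand s a).comp (by fun_prop)).aestronglyMeasurable
  · filter_upwards [eventually_ge_atTop (a + 1)] with R hR
    refine Eventually.of_forall fun y hy => ?_
    rw [Set.uIoc_of_le (by linarith)] at hy
    have hy' : |y| ≤ Real.pi := abs_le.2 ⟨hy.1.le, hy.2⟩
    rw [hform R y (by linarith), norm_div]
    have h1 : ‖Complex.exp (-Complex.exp (s * (R + y * Complex.I)))‖ ≤ 1 :=
      norm_cexp_neg_cexp_le_one hs0 hs (by simpa using hy')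
    have h2 : ‖Complex.exp (-Complex.exp (s * a))‖ ≤ 1 :=
      norm_cexp_neg_cexp_le_one hs0 hs (by simp [hpi.le])
    have h3 : Real.exp (a - R) ≤ 1 / 2 := by
      have h4 : Real.exp (a - R) ≤ Real.exp (-1) := Real.exp_le_exp.2 (by linarith)
      have := Real.exp_neg_one_lt_half
      linarith
    have h5 : (1 / 2 : ℝ) ≤ ‖1 - Complex.exp (a - (R + y * Complex.I))‖ := by
      have := norm_sub_norm_le (1 : ℂ) (Complex.exp (a - (R + y * Complex.I)))
      rw [hn, norm_one] at this
      linarith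
    rw [div_le_iff₀ (by linarith)]
    have := norm_sub_le (Complex.exp (-Complex.exp (s * (R + y * Complex.I))))
      (Complex.exp (-Complex.exp (s * a)))
    linarith
  · refine Eventually.of_forall fun y hy => ?_
    rw [Set.uIoc_of_le (by linarith)] at hy
    have hy' : |y| ≤ Real.pi := abs_le.2 ⟨hy.1.le, hy.2⟩
    have hc := cos_mul_pos_of_abs_le_pi hs0 hs hy'
    have t1 : Tendsto (fun R : ℝ => Complex.exp (-Complex.exp (s * (R + y * Complex.I)))) atTop
        (𝓝 0) := by
      rw [tendsto_zero_iff_norm_tendsto_zero]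
      simp_rw [norm_cexp_neg_cexp]
      simp only [Complex.add_re, Complex.ofReal_re, Complex.mul_re, Complex.I_re, mul_zero,
        Complex.ofReal_im, Complex.I_im, mul_one, sub_self, add_zero, Complex.add_im,
            Complex.mul_im,
        zero_add]
      refine Real.tendsto_exp_neg_atTop_nhds_zero.comp (Tendsto.atTop_mul_const hc ?_)
      exact Real.tendsto_exp_atTop.comp (tendsto_id.const_mul_atTop hs0)
    have t2 : Tendsto (fun R : ℝ => Complex.exp (a - (R + y * Complex.I))) atTop (𝓝 0) := by
      rw [tendsto_zero_iff_norm_tendsto_zero]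
      simp_rw [hn]
      refine Real.tendsto_exp_atBot.comp ?_
      exact tendsto_atBot_add_const_left _ a tendsto_neg_atTop_atBot
    have t3 := (t1.sub_const (Complex.exp (-Complex.exp (s * a)))).div
      (tendsto_const_nhds (x := (1 : ℂ)) |>.sub t2) (by norm_num)
    have e : (0 - Complex.exp (-Complex.exp (s * a))) / (1 - 0) =
        -(Real.exp (-Real.exp (s * a)) : ℝ) := by
      push_cast; simp
    rw [e] at t3
    refine t3.congr' ?_
    filter_upwards [eventually_gt_atTop a] with R hR
    exact (hform R y hR).symm

theorem tendsto_stripIntegrand_left (s a : ℝ) (hs0 : 0 < s) (hs : s < 1 / 2) :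
    Tendsto (fun R : ℝ => ∫ y in -Real.pi..Real.pi, stripIntegrand s a ((-R : ℝ) + y * Complex.I))
      atTop (𝓝 0) := by
  have hpi := Real.pi_pos
  have hform : ∀ R y : ℝ, -R < a → stripIntegrand s a ((-R : ℝ) + y * Complex.I) =
      (Complex.exp (-Complex.exp (s * ((-R : ℝ) + y * Complex.I))) -
          Complex.exp (-Complex.exp (s * a))) /
        (Complex.exp ((-R : ℝ) + y * Complex.I) - Complex.exp a) *
            Complex.exp ((-R : ℝ) + y * Complex.I) := by
    intro R y hR
    apply stripIntegrand_of_ne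
    intro h
    have := congrArg Complex.re h
    simp at this
    linarith
  have hn : ∀ R y : ℝ, ‖Complex.exp ((-R : ℝ) + y * Complex.I)‖ = Real.exp (-R) := by
    intro R y
    rw [Complex.norm_exp]; simp
  have hb : ∀ᶠ R : ℝ in atTop, ∀ y ∈ Set.uIoc (-Real.pi) Real.pi,
      ‖stripIntegrand s a ((-R : ℝ) + y * Complex.I)‖ ≤ 4 / Real.exp a * Real.exp (-R) := by
    filter_upwards [eventually_ge_atTop (1 - a)] with R hR y hy
    rw [Set.uIoc_of_le (by linarith)] at hy
    have hy' : |y| ≤ Real.pi := abs_le.2 ⟨hy.1.le, hy.2⟩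
    rw [hform R y (by linarith), norm_mul, norm_div, hn]
    refine mul_le_mul_of_nonneg_right ?_ (Real.exp_pos _).le
    have h1 : ‖Complex.exp (-Complex.exp (s * ((-R : ℝ) + y * Complex.I)))‖ ≤ 1 :=
      norm_cexp_neg_cexp_le_one hs0 hs (by simpa using hy')
    have h2 : ‖Complex.exp (-Complex.exp (s * a))‖ ≤ 1 :=
      norm_cexp_neg_cexp_le_one hs0 hs (by simp [hpi.le])
    have h3 : Real.exp (-R) ≤ Real.exp a / 2 := by
      have h4 : Real.exp (-R) ≤ Real.exp (a + -1) := Real.exp_le_exp.2 (by linarith)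
      rw [Real.exp_add] at h4
      have := Real.exp_neg_one_lt_half
      nlinarith [Real.exp_pos a]
    have h5 : (Real.exp a / 2 : ℝ) ≤ ‖Complex.exp ((-R : ℝ) + y * Complex.I) - Complex.exp a‖ := by
      have := norm_sub_norm_le (Complex.exp a) (Complex.exp ((-R : ℝ) + y * Complex.I))
      rw [hn, norm_sub_rev, Complex.norm_exp, Complex.ofReal_re] at this
      linarith
    have h6 := Real.exp_pos a
    rw [div_le_iff₀ (by linarith), div_mul_eq_mul_div, le_div_iff₀ h6]
    have := norm_sub_le (Complex.exp (-Complex.exp (s * ((-R : ℝ) + y * Complex.I))))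
      (Complex.exp (-Complex.exp (s * a)))
    nlinarith
  refine squeeze_zero_norm' (a := fun R => 4 / Real.exp a * Real.exp (-R) *
      |Real.pi - -Real.pi|) ?_ ?_
  · filter_upwards [hb] with R hR
    exact intervalIntegral.norm_integral_le_of_norm_le_const hR
  · have := (Real.tendsto_exp_neg_atTop_nhds_zero.const_mul (4 / Real.exp a)).mul_const
      |Real.pi - -Real.pi|
    simpa using this

/-- Cauchy's theorem in the strip: letting the rectangle grow to the whole strip. -/
theorem tendsto_integral_stableJump (s a : ℝ) (hs0 : 0 < s) (hs : s < 1 / 2) :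
    Tendsto (fun R : ℝ => ∫ x in -R..R,
        stableJump s (Real.exp x) / (Real.exp x + Real.exp a) * Real.exp x) atTop
      (𝓝 (Real.pi * Real.exp (-Real.exp (s * a)))) := by
  have hT := ((tendsto_stripIntegrand_left s a hs0 hs).sub
      (tendsto_stripIntegrand_right s a hs0 hs)).const_mul (1 / 2 : ℂ)
  have e : (1 / 2 : ℂ) * (0 - -((2 * Real.pi * Real.exp (-Real.exp (s * a)) : ℝ) : ℂ)) =
      ((Real.pi * Real.exp (-Real.exp (s * a)) : ℝ) : ℂ) := by
    push_cast; ring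
  rw [e] at hT
  have h2 := (Complex.continuous_re.tendsto _).comp hT
  rw [Complex.ofReal_re] at h2
  refine h2.congr' ?_
  filter_upwards [eventually_gt_atTop 0] with R hR
  have hrect := stripIntegrand_rect s a R
  have hcont : ∀ y : ℝ, |y| ≤ Real.pi → Continuous fun x : ℝ =>
      stripIntegrand s a (x + y * Complex.I) := by
    intro y hy
    have h1 := (differentiable_dslope_of_differentiable (differentiable_cexp_neg_cexp s)
        a).continuous
    have h2 := (differentiable_dslope_of_differentiable Complex.differentiable_exp a).continuous
    have hl : Continuous fun x : ℝ => (x + y * Complex.I : ℂ) := by fun_prop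
    refine ((h1.comp hl).div (h2.comp hl) fun x => ?_).mul (Complex.continuous_exp.comp hl)
    exact dslope_cexp_ne_zero a (by simpa using hy)
  have hpi := abs_of_pos Real.pi_pos
  have c1 := hcont (-Real.pi) (by rw [abs_neg, hpi])
  have c2 := hcont Real.pi hpi.le
  rw [← intervalIntegral.integral_sub (c1.intervalIntegrable _ _) (c2.intervalIntegrable _ _)]
    at hrect
  simp_rw [stripIntegrand_jump] at hrect
  rw [intervalIntegral.integral_const_mul, intervalIntegral.integral_ofReal] at hrect
  simp only [smul_eq_mul] at hrect
  have : ((∫ x in -R..R, stableJump s (Real.exp x) / (Real.exp x + Real.exp a) * Real.exp x : ℝ) :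
      ℂ) =
    1 / 2 * ((∫ y in -Real.pi..Real.pi, stripIntegrand s a ((-R : ℝ) + y * Complex.I)) -
     ∫ y in -Real.pi..Real.pi, stripIntegrand s a (R + y * Complex.I)) := by
    have hI : Complex.I ≠ 0 := Complex.I_ne_zero
    apply mul_left_cancel₀ hI
    linear_combination (1 / 2 : ℂ) * hrect
  simp only [Function.comp]
  rw [← this, Complex.ofReal_re]

theorem cos_pi_mul_pos {s : ℝ} (hs0 : 0 < s) (hs : s < 1 / 2) : 0 < Real.cos (Real.pi * s) := by
  rw [mul_comm]
  exact cos_mul_pos_of_abs_le_pi hs0 hs (abs_of_pos Real.pi_pos).le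

theorem sin_pi_mul_pos {s : ℝ} (hs0 : 0 < s) (hs : s < 1 / 2) : 0 < Real.sin (Real.pi * s) := by
  have := Real.pi_pos
  apply Real.sin_pos_of_pos_of_lt_pi <;> nlinarith

theorem continuous_stableJump {s : ℝ} (hs0 : 0 < s) : Continuous (stableJump s) := by
  unfold stableJump
  have : Continuous fun r : ℝ => r ^ s := continuous_id.rpow_const fun x => Or.inr hs0.le
  fun_prop

theorem abs_stableJump_le_exp (s r : ℝ) :
    |stableJump s r| ≤ Real.exp (-Real.cos (Real.pi * s) * r ^ s) := by
  rw [stableJump, abs_mul, abs_of_pos (Real.exp_pos _), neg_mul]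
  exact mul_le_of_le_one_right (Real.exp_pos _).le (Real.abs_sin_le_one _)

theorem abs_stableJump_le_rpow {s r : ℝ} (hs0 : 0 < s) (hs : s < 1 / 2) (hr : 0 ≤ r) :
    |stableJump s r| ≤ Real.sin (Real.pi * s) * r ^ s := by
  have hc := cos_pi_mul_pos hs0 hs
  have hd := sin_pi_mul_pos hs0 hs
  have hr' := Real.rpow_nonneg hr s
  rw [stableJump, abs_mul, abs_of_pos (Real.exp_pos _)]
  have h1 : Real.exp (-(Real.cos (Real.pi * s) * r ^ s)) ≤ 1 := by
    rw [Real.exp_le_one_iff]; nlinarith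
  have h2 := Real.abs_sin_le_abs (x := Real.sin (Real.pi * s) * r ^ s)
  rw [abs_of_nonneg (by positivity : 0 ≤ Real.sin (Real.pi * s) * r ^ s)] at h2
  calc _ ≤ 1 * |Real.sin (Real.sin (Real.pi * s) * r ^ s)| := by gcongr
    _ ≤ _ := by rw [one_mul]; exact h2

theorem integrableOn_stableJump {s : ℝ} (hs0 : 0 < s) (hs : s < 1 / 2) :
    IntegrableOn (stableJump s) (Set.Ioi 0) := by
  have h := integrableOn_rpow_mul_exp_neg_mul_rpow (p := s) (s := 0) (by norm_num) hs0
    (cos_pi_mul_pos hs0 hs)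
  refine Integrable.mono' h (continuous_stableJump hs0).aestronglyMeasurable ?_
  refine Eventually.of_forall fun r => ?_
  rw [Real.rpow_zero, one_mul]
  exact abs_stableJump_le_exp s r

/-- Stieltjes representation of the stretched exponential `exp (-lam ^ s)`. -/
theorem integral_stableJump_div {s lam : ℝ} (hs0 : 0 < s) (hs : s < 1 / 2) (hlam : 0 < lam) :
    ∫ r in Set.Ioi (0 : ℝ), stableJump s r / (r + lam) = Real.pi * Real.exp (-lam ^ s) := by
  have hT := tendsto_integral_stableJump s (Real.log lam) hs0 hs
  have e : Real.exp (s * Real.log lam) = lam ^ s := by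
    rw [Real.rpow_def_of_pos hlam, mul_comm]
  rw [e, Real.exp_log hlam] at hT
  have hg : ContinuousOn (fun r => stableJump s r / (r + lam)) (Set.Ici 0) := by
    refine (continuous_stableJump hs0).continuousOn.div (by fun_prop) fun r hr => ?_
    have : (0 : ℝ) ≤ r := hr
    positivity
  have hint : IntegrableOn (fun r => stableJump s r / (r + lam)) (Set.Ioi 0) := by
    refine Integrable.mono' ((integrableOn_stableJump hs0 hs).norm.div_const lam)
      ((hg.mono Set.Ioi_subset_Ici_self).aestronglyMeasurable measurableSet_Ioi) ?_
    filter_upwards [ae_restrict_mem measurableSet_Ioi] with r hr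
    have : (0 : ℝ) < r := hr
    rw [norm_div, Real.norm_of_nonneg (by positivity : 0 ≤ r + lam)]
    gcongr
    linarith
  have hsub : ∀ R : ℝ, 0 < R → (∫ x in -R..R, stableJump s (Real.exp x) / (Real.exp x + lam) *
      Real.exp x) =
      (∫ r in (0 : ℝ)..Real.exp R, stableJump s r / (r + lam)) -
        ∫ r in (0 : ℝ)..Real.exp (-R), stableJump s r / (r + lam) := by
    intro R hR
    have hii : ∀ b : ℝ, 0 ≤ b → IntervalIntegrable (fun r =>
        stableJump s r / (r + lam)) volume 0 b := by
      intro b hb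
      rw [intervalIntegrable_iff_integrableOn_Ioc_of_le hb]
      exact hint.mono_set Set.Ioc_subset_Ioi_self
    rw [intervalIntegral.integral_interval_sub_left (hii _ (Real.exp_pos _).le)
        (hii _ (Real.exp_pos _).le)]
    have := intervalIntegral.integral_comp_mul_deriv''' (a := -R) (b := R) (f := Real.exp)
      (f' := Real.exp) (g := fun r => stableJump s r / (r + lam)) Real.continuous_exp.continuousOn
      (fun x _ => (Real.hasDerivAt_exp x).hasDerivWithinAt) ?_ ?_ ?_
    · rw [← this]; rfl
    · refine hg.mono ?_
      rintro _ ⟨x, -, rfl⟩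
      exact (Real.exp_pos x).le
    · have h0 : Set.InjOn Real.exp (Set.uIcc (-R) R) := Real.exp_injective.injOn
      refine hint.mono_set ?_
      rintro _ ⟨x, -, rfl⟩
      exact Real.exp_pos x
    · have hc : Continuous fun x => stableJump s (Real.exp x) / (Real.exp x + lam) *
          Real.exp x := by
        refine (((continuous_stableJump hs0).comp Real.continuous_exp).div (by fun_prop) fun x =>
            ?_).mul
          Real.continuous_exp
        positivity
      exact hc.continuousOn.integrableOn_compact isCompact_uIcc
  have t1 := intervalIntegral_tendsto_integral_Ioi 0 hint Real.tendsto_exp_atTop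
  have t2 : Tendsto (fun R : ℝ => ∫ r in (0 : ℝ)..Real.exp (-R),
      stableJump s r / (r + lam)) atTop (𝓝 0) := by
    have hc : ContinuousOn (fun b => ∫ r in (0 : ℝ)..b,
        stableJump s r / (r + lam)) (Set.uIcc 0 1) := by
      refine intervalIntegral.continuousOn_primitive_interval (μ := volume)
        (f := fun r => stableJump s r / (r + lam)) (a := 0) (b := 1) ?_
      rw [Set.uIcc_of_le zero_le_one]
      exact (hg.mono Set.Icc_subset_Ici_self).integrableOn_Icc
    have h0 := (hc 0 (by simp)).tendsto
    rw [Set.uIcc_of_le zero_le_one] at h0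
    rw [intervalIntegral.integral_same] at h0
    refine h0.comp (tendsto_nhdsWithin_iff.2 ⟨Real.tendsto_exp_neg_atTop_nhds_zero, ?_⟩)
    filter_upwards [eventually_gt_atTop 0] with R hR
    exact ⟨(Real.exp_pos _).le, Real.exp_le_one_iff.2 (by linarith)⟩
  have t3 := t1.sub t2
  rw [sub_zero] at t3
  refine tendsto_nhds_unique t3 (hT.congr' ?_)
  filter_upwards [eventually_gt_atTop 0] with R hR
  exact hsub R hR

/-! ### The one-sided stable density -/

/-- The density of the one-sided `s`-stable law, as the Laplace transform of the jump
of `exp (-z ^ s)` across its cut. -/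
noncomputable def stableDensity (s u : ℝ) : ℝ :=
  Real.pi⁻¹ * ∫ r in Set.Ioi (0 : ℝ), Real.exp (-(u * r)) * stableJump s r

/-- The constant in the tail `stableDensity s u ∼ stableConst s * u ^ (-1 - s)`. -/
noncomputable def stableConst (s : ℝ) : ℝ :=
  Real.pi⁻¹ * (Real.sin (Real.pi * s) * Real.Gamma (s + 1))

theorem stableConst_pos {s : ℝ} (hs0 : 0 < s) (hs : s < 1 / 2) : 0 < stableConst s := by
  have h1 := sin_pi_mul_pos hs0 hs
  have h2 := Real.Gamma_pos_of_pos (by linarith : 0 < s + 1)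
  have := Real.pi_pos
  unfold stableConst
  positivity

theorem measurable_stableDensity {s : ℝ} (hs0 : 0 < s) : Measurable (stableDensity s) := by
  have hc : Continuous fun p : ℝ × ℝ => Real.exp (-(p.1 * p.2)) * stableJump s p.2 := by
    have := continuous_stableJump hs0
    fun_prop
  exact (hc.stronglyMeasurable.integral_prod_right
    (ν := volume.restrict (Set.Ioi (0 : ℝ)))).measurable.const_mul _

theorem integrableOn_rpow_mul_exp_neg_mul {a r : ℝ} (ha : -1 < a) (hr : 0 < r) :
    IntegrableOn (fun x => x ^ a * Real.exp (-(r * x))) (Set.Ioi 0) := by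
  simpa using integrableOn_rpow_mul_exp_neg_mul_rpow (p := 1) ha one_pos hr

theorem abs_stableDensity_le_const {s u : ℝ} (hs0 : 0 < s) (hs : s < 1 / 2) (hu : 0 ≤ u) :
    |stableDensity s u| ≤ Real.pi⁻¹ * ∫ r in Set.Ioi (0 : ℝ), |stableJump s r| := by
  have := Real.pi_pos
  rw [stableDensity, abs_mul, abs_of_pos (by positivity)]
  gcongr
  rw [← Real.norm_eq_abs]
  refine norm_integral_le_of_norm_le (integrableOn_stableJump hs0 hs).norm ?_
  filter_upwards [ae_restrict_mem measurableSet_Ioi] with r hr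
  have hr : (0 : ℝ) < r := hr
  rw [norm_mul, Real.norm_of_nonneg (Real.exp_pos _).le]
  refine mul_le_of_le_one_left (norm_nonneg _) ?_
  rw [Real.exp_le_one_iff]
  nlinarith

theorem abs_stableDensity_le_rpow {s u : ℝ} (hs0 : 0 < s) (hs : s < 1 / 2) (hu : 0 < u) :
    |stableDensity s u| ≤ stableConst s * u ^ (-1 - s) := by
  have := Real.pi_pos
  have hint := integrableOn_rpow_mul_exp_neg_mul (a := s) (by linarith) hu
  rw [stableDensity, abs_mul, abs_of_pos (by positivity), stableConst, mul_assoc]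
  gcongr
  have e : Real.sin (Real.pi * s) * Real.Gamma (s + 1) * u ^ (-1 - s) =
      ∫ r in Set.Ioi (0 : ℝ), Real.sin (Real.pi * s) * (r ^ s * Real.exp (-(u * r))) := by
    rw [integral_const_mul]
    have h := Real.integral_rpow_mul_exp_neg_mul_Ioi (a := s + 1) (by linarith) hu
    rw [add_sub_cancel_right] at h
    rw [h, one_div, Real.inv_rpow hu.le, ← Real.rpow_neg hu.le]
    ring_nf
  rw [e]
  rw [← Real.norm_eq_abs]
  refine norm_integral_le_of_norm_le (hint.const_mul _) ?_
  filter_upwards [ae_restrict_mem measurableSet_Ioi] with r hr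
  have hr : (0 : ℝ) < r := hr
  rw [norm_mul, Real.norm_of_nonneg (Real.exp_pos _).le]
  have := abs_stableJump_le_rpow hs0 hs hr.le
  have := Real.exp_pos (-(u * r))
  calc _ ≤ Real.exp (-(u * r)) * (Real.sin (Real.pi * s) * r ^ s) := by gcongr; assumption
    _ = _ := by ring

theorem integrableOn_stableDensity {s : ℝ} (hs0 : 0 < s) (hs : s < 1 / 2) :
    IntegrableOn (stableDensity s) (Set.Ioi 0) := by
  rw [← Set.Ioc_union_Ioi_eq_Ioi zero_le_one]
  refine IntegrableOn.union ?_ ?_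
  · refine Measure.integrableOn_of_bounded (M := Real.pi⁻¹ * ∫ r in Set.Ioi (0 : ℝ),
        |stableJump s r|)
      (by simp) (measurable_stableDensity hs0).aestronglyMeasurable ?_
    filter_upwards [ae_restrict_mem measurableSet_Ioc] with u hu
    exact abs_stableDensity_le_const hs0 hs hu.1.le
  · refine Integrable.mono' ((integrableOn_Ioi_rpow_of_lt
        (a := -1 - s) (by linarith) one_pos).const_mul
      (stableConst s)) (measurable_stableDensity hs0).aestronglyMeasurable ?_
    filter_upwards [ae_restrict_mem measurableSet_Ioi] with u hu
    exact abs_stableDensity_le_rpow hs0 hs (lt_trans one_pos hu)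

/-- The Laplace transform of the one-sided stable density. -/
theorem integral_exp_neg_mul_stableDensity {s lam : ℝ} (hs0 : 0 < s) (hs : s < 1 / 2)
    (hlam : 0 < lam) :
    ∫ u in Set.Ioi (0 : ℝ), Real.exp (-(lam * u)) * stableDensity s u = Real.exp (-lam ^ s) := by
  have hexp : ∀ b : ℝ, 0 < b → IntegrableOn (fun u => Real.exp (-(b * u))) (Set.Ioi 0) := by
    intro b hb
    simpa using integrableOn_rpow_mul_exp_neg_mul (a := 0) (by norm_num) hb
  have hint : Integrable (Function.uncurry fun u r : ℝ =>
      Real.exp (-(lam * u)) * (Real.exp (-(u * r)) * stableJump s r))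
      ((volume.restrict (Set.Ioi 0)).prod (volume.restrict (Set.Ioi 0))) := by
    have hc : Continuous (Function.uncurry fun u r : ℝ =>
      Real.exp (-(lam * u)) * (Real.exp (-(u * r)) * stableJump s r)) := by
      have := continuous_stableJump hs0
      unfold Function.uncurry
      fun_prop
    refine Integrable.mono' ((hexp lam hlam).mul_prod (integrableOn_stableJump hs0 hs).norm)
      hc.aestronglyMeasurable ?_
    rw [Measure.prod_restrict]
    filter_upwards [ae_restrict_mem (measurableSet_Ioi.prod measurableSet_Ioi)] with p hp
    have h1 : (0 : ℝ) < p.1 := hp.1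
    have h2 : (0 : ℝ) < p.2 := hp.2
    simp only [Function.uncurry, norm_mul, Real.norm_of_nonneg (Real.exp_pos _).le]
    gcongr
    refine mul_le_of_le_one_left (norm_nonneg _) ?_
    rw [Real.exp_le_one_iff]
    nlinarith
  have hpull : ∀ u : ℝ, Real.exp (-(lam * u)) * stableDensity s u =
      Real.pi⁻¹ * ∫ r in Set.Ioi (0 : ℝ), Real.exp (-(lam * u)) *
          (Real.exp (-(u * r)) * stableJump s r) := by
    intro u
    rw [integral_const_mul, stableDensity]
    ring
  simp_rw [hpull]
  rw [integral_const_mul, integral_integral_swap hint]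
  have hin : ∀ r ∈ Set.Ioi (0 : ℝ), (∫ u in Set.Ioi (0 : ℝ),
      Real.exp (-(lam * u)) * (Real.exp (-(u * r)) * stableJump s r)) =
        stableJump s r / (r + lam) := by
    intro r hr
    have hr : (0 : ℝ) < r := hr
    have h := Real.integral_rpow_mul_exp_neg_mul_Ioi (a := 1) one_pos (by positivity : 0 < r + lam)
    simp only [sub_self, Real.rpow_zero, one_mul, Real.rpow_one, Real.Gamma_one, mul_one] at h
    have : ∀ u : ℝ, Real.exp (-(lam * u)) * (Real.exp (-(u * r)) * stableJump s r) =
        Real.exp (-((r + lam) * u)) * stableJump s r := by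
      intro u
      rw [← mul_assoc, ← Real.exp_add]
      ring_nf
    simp_rw [this]
    rw [integral_mul_const, h]
    ring
  rw [setIntegral_congr_fun measurableSet_Ioi hin, integral_stableJump_div hs0 hs hlam,
    inv_mul_cancel_left₀ Real.pi_ne_zero]

/-- The tail of the one-sided stable density, read off from `stableJump s r ∼ sin (π s) r ^ s`
at `r = 0` (Watson's lemma). -/
theorem tendsto_rpow_mul_stableDensity {s : ℝ} (hs0 : 0 < s) (hs : s < 1 / 2) :
    Tendsto (fun u => u ^ (1 + s) * stableDensity s u) atTop (𝓝 (stableConst s)) := by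
  have hd := sin_pi_mul_pos hs0 hs
  -- the substitution `r = x / u`
  have hform : ∀ u : ℝ, 0 < u → u ^ (1 + s) * stableDensity s u =
      Real.pi⁻¹ * ∫ x in Set.Ioi (0 : ℝ), Real.exp (-x) * (u ^ s * stableJump s (x / u)) := by
    intro u hu
    have h := integral_comp_mul_left_Ioi (fun x => Real.exp (-x) *
        (u ^ s * stableJump s (x / u))) 0 hu
    rw [mul_zero, smul_eq_mul, eq_inv_mul_iff_mul_eq₀ hu.ne'] at h
    rw [← h, stableDensity, Real.rpow_add hu, Real.rpow_one]
    have : ∀ r : ℝ, Real.exp (-(u * r)) * (u ^ s * stableJump s (u * r / u)) =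
        u ^ s * (Real.exp (-(u * r)) * stableJump s r) := by
      intro r
      rw [mul_div_cancel_left₀ _ hu.ne']
      ring
    simp_rw [this]
    rw [integral_const_mul]
    ring
  have hG : Real.sin (Real.pi * s) * Real.Gamma (s + 1) =
      ∫ x in Set.Ioi (0 : ℝ), Real.exp (-x) * (Real.sin (Real.pi * s) * x ^ s) := by
    rw [Real.Gamma_eq_integral (by linarith), ← integral_const_mul]
    refine integral_congr_ae (Eventually.of_forall fun x => ?_)
    simp only [add_sub_cancel_right]
    ring
  have hlim : Tendsto (fun u : ℝ => ∫ x in Set.Ioi (0 : ℝ),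
      Real.exp (-x) * (u ^ s * stableJump s (x / u)))
      atTop (𝓝 (Real.sin (Real.pi * s) * Real.Gamma (s + 1))) := by
    rw [hG]
    refine tendsto_integral_filter_of_dominated_convergence
      (fun x => Real.sin (Real.pi * s) * (x ^ s * Real.exp (-(1 * x)))) ?_ ?_
      ((integrableOn_rpow_mul_exp_neg_mul (by linarith) one_pos).const_mul _) ?_
    · refine Eventually.of_forall fun u => Continuous.aestronglyMeasurable ?_
      have := continuous_stableJump hs0
      fun_prop
    · filter_upwards [eventually_gt_atTop 0] with u hu
      filter_upwards [ae_restrict_mem measurableSet_Ioi] with x hx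
      have hx : (0 : ℝ) < x := hx
      have hus : 0 < u ^ s := Real.rpow_pos_of_pos hu s
      rw [norm_mul, norm_mul, Real.norm_of_nonneg (Real.exp_pos _).le, Real.norm_of_nonneg hus.le,
        Real.norm_eq_abs]
      have hb := abs_stableJump_le_rpow hs0 hs (div_pos hx hu).le
      rw [Real.div_rpow hx.le hu.le] at hb
      calc _ ≤ Real.exp (-x) * (u ^ s * (Real.sin (Real.pi * s) * (x ^ s / u ^ s))) := by gcongr
        _ = _ := by rw [one_mul]; field_simp
    · filter_upwards [ae_restrict_mem measurableSet_Ioi] with x hx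
      have hx : (0 : ℝ) < x := hx
      refine Tendsto.const_mul _ ?_
      -- with `y = (x / u) ^ s → 0`, the quantity is `x ^ s * (exp (-c y) * sin (d y) / y)`
      have hy : Tendsto (fun u : ℝ => (x / u) ^ s) atTop (𝓝[≠] 0) := by
        rw [tendsto_nhdsWithin_iff]
        constructor
        · have h1 : Tendsto (fun u : ℝ => x / u) atTop (𝓝 0) := tendsto_id.const_div_atTop x
          have h2 := h1.rpow_const (p := s) (Or.inr hs0.le)
          rwa [Real.zero_rpow hs0.ne'] at h2
        · filter_upwards [eventually_gt_atTop 0] with u hu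
          exact (Real.rpow_pos_of_pos (div_pos hx hu) s).ne'
      have hder : HasDerivAt (fun y => Real.exp (-(Real.cos (Real.pi * s) * y)) *
          Real.sin (Real.sin (Real.pi * s) * y)) (Real.sin (Real.pi * s)) 0 := by
        have h1 : HasDerivAt (fun y => Real.exp (-(Real.cos (Real.pi * s) * y))) _ 0 :=
          (((hasDerivAt_id (0 : ℝ)).const_mul (Real.cos (Real.pi * s))).neg).exp
        have h2 : HasDerivAt (fun y => Real.sin (Real.sin (Real.pi * s) * y)) _ 0 :=
          ((hasDerivAt_id (0 : ℝ)).const_mul (Real.sin (Real.pi * s))).sin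
        have h3 := h1.fun_mul h2
        simpa using h3
      have hsl := (hasDerivAt_iff_tendsto_slope.1 hder).comp hy
      have h4 := hsl.mul_const (x ^ s)
      refine h4.congr' ?_
      filter_upwards [eventually_gt_atTop 0] with u hu
      have hus : 0 < u ^ s := Real.rpow_pos_of_pos hu s
      have hxs : 0 < x ^ s := Real.rpow_pos_of_pos hx s
      simp only [Function.comp, slope_def_field, mul_zero, Real.sin_zero, sub_zero]
      rw [← stableJump, Real.div_rpow hx.le hu.le]
      field_simp
  refine (hlim.const_mul Real.pi⁻¹).congr' ?_
  filter_upwards [eventually_gt_atTop 0] with u hu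
  exact (hform u hu).symm

/-! ### Subordination of the fractional heat kernel -/

section

/-- The heat kernel of `ℝⁿ` at time `v`. -/
noncomputable def gaussKernel {n : ℕ} (z : EuclideanSpace ℝ (Fin n)) (v : ℝ) : ℝ :=
  (4 * Real.pi * v) ^ (-(n / 2 : ℝ)) * Real.exp (-(‖z‖ ^ 2 / (4 * v)))

variable {n : ℕ}

theorem gaussKernel_nonneg (z : EuclideanSpace ℝ (Fin n)) {v : ℝ} (hv : 0 ≤ v) :
    0 ≤ gaussKernel z v := by
  have := Real.pi_pos
  unfold gaussKernel
  positivity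

theorem measurable_gaussKernel :
    Measurable (Function.uncurry (gaussKernel (n := n))) := by
  unfold Function.uncurry gaussKernel
  fun_prop

theorem integrable_exp_neg_mul_norm_sq {b : ℝ} (hb : 0 < b) :
    Integrable fun ξ : EuclideanSpace ℝ (Fin n) => Real.exp (-(b * ‖ξ‖ ^ 2)) := by
  have h := (GaussianFourier.integrable_cexp_neg_mul_sq_norm_add
      (b := (b : ℂ)) (by simpa using hb) 0
    (0 : EuclideanSpace ℝ (Fin n))).norm
  refine h.congr (Eventually.of_forall fun ξ => ?_)
  simp only [Complex.norm_exp]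
  congr 1
  simp [← Complex.ofReal_pow, ← Complex.ofReal_mul]

theorem norm_cexp_I_mul_inner (z ξ : EuclideanSpace ℝ (Fin n)) :
    ‖Complex.exp (Complex.I * ((inner ℝ z ξ : ℝ) : ℂ))‖ = 1 := by
  rw [mul_comm]; exact Complex.norm_exp_ofReal_mul_I _

theorem integrable_cexp_mul_of_integrable {f : EuclideanSpace ℝ (Fin n) → ℝ} (hf : Integrable f)
    (z : EuclideanSpace ℝ (Fin n)) :
    Integrable fun ξ => Complex.exp (Complex.I * ((inner ℝ z ξ : ℝ) : ℂ)) * ((f ξ : ℝ) : ℂ) := by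
  refine hf.ofReal.bdd_mul (c := 1) (Continuous.aestronglyMeasurable (by fun_prop)) ?_
  exact Eventually.of_forall fun ξ => (norm_cexp_I_mul_inner z ξ).le

theorem integral_cexp_mul_exp_neg_mul_norm_sq {b : ℝ} (hb : 0 < b)
    (z : EuclideanSpace ℝ (Fin n)) :
    ∫ ξ : EuclideanSpace ℝ (Fin n), Complex.exp (Complex.I * ((inner ℝ z ξ : ℝ) : ℂ)) *
        ((Real.exp (-(b * ‖ξ‖ ^ 2)) : ℝ) : ℂ) =
      (((Real.pi / b) ^ (n / 2 : ℝ) * Real.exp (-(‖z‖ ^ 2 / (4 * b))) : ℝ) : ℂ) := by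
  have h := GaussianFourier.integral_cexp_neg_mul_sq_norm_add (b := (b : ℂ)) (by simpa using hb)
    Complex.I z
  rw [finrank_euclideanSpace_fin] at h
  convert h using 1
  · refine integral_congr_ae (Eventually.of_forall fun ξ => ?_)
    simp only
    rw [Complex.ofReal_exp, ← Complex.exp_add]
    congr 1
    push_cast
    ring
  · have := Real.pi_pos
    rw [Complex.ofReal_mul, Complex.ofReal_cpow (by positivity), Complex.ofReal_exp]
    congr 2
    · push_cast; rfl
    · push_cast; rfl
    · push_cast; rw [Complex.I_sq]; ring

theorem two_pi_pow_mul_rpow {v : ℝ} (hv : 0 < v) :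
    ((2 * Real.pi) ^ n)⁻¹ * (Real.pi / v) ^ (n / 2 : ℝ) = (4 * Real.pi * v) ^ (-(n / 2 : ℝ)) := by
  have hpi := Real.pi_pos
  have h1 : ((2 * Real.pi) ^ n : ℝ) = ((2 * Real.pi) ^ 2) ^ (n / 2 : ℝ) := by
    rw [← Real.rpow_natCast, ← Real.rpow_natCast, ← Real.rpow_mul (by positivity)]
    congr 1; push_cast; ring
  rw [h1, Real.rpow_neg (by positivity), ← Real.inv_rpow (by positivity),
    ← Real.inv_rpow (by positivity), ← Real.mul_rpow (by positivity) (by positivity)]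
  congr 1
  field_simp
  ring

theorem rpow_mul_exp_neg_le {a b w : ℝ} (ha : 0 < a) (hb : 0 < b) (hw : 0 ≤ w) :
    w ^ a * Real.exp (-(b * w)) ≤ (a / b) ^ a := by
  have h1 : w ≤ a / b * Real.exp (b * w / a) := by
    have h2 : b * w / a ≤ Real.exp (b * w / a) := by linarith [Real.add_one_le_exp (b * w / a)]
    calc w = a / b * (b * w / a) := by field_simp
      _ ≤ _ := by gcongr
  have h3 : w ^ a ≤ (a / b) ^ a * Real.exp (b * w) := by
    calc w ^ a ≤ (a / b * Real.exp (b * w / a)) ^ a := by gcongr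
      _ = _ := by
        rw [Real.mul_rpow (by positivity) (by positivity), ← Real.exp_mul]
        congr 2
        field_simp
  calc _ ≤ (a / b) ^ a * Real.exp (b * w) * Real.exp (-(b * w)) := by gcongr
    _ = _ := by rw [mul_assoc, ← Real.exp_add, add_neg_cancel, Real.exp_zero, mul_one]

theorem integrable_exp_neg_mul_norm_rpow [NeZero n] {t p : ℝ} (ht : 0 < t) (hp : 0 < p) :
    Integrable fun ξ : EuclideanSpace ℝ (Fin n) => Real.exp (-t * ‖ξ‖ ^ p) := by
  have h := (integrable_fun_norm_addHaar (volume : Measure (EuclideanSpace ℝ (Fin n)))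
    (f := fun r => Real.exp (-t * r ^ p)))
  rw [h]
  have h2 := integrableOn_rpow_mul_exp_neg_mul_rpow (p := p) (s := ((n - 1 : ℕ) : ℝ)) (b := t)
    (by have : (0 : ℝ) ≤ ((n - 1 : ℕ) : ℝ) := by positivity
        linarith) hp ht
  refine h2.congr_fun (fun r _ => ?_) measurableSet_Ioi
  simp only [finrank_euclideanSpace_fin, smul_eq_mul, Real.rpow_natCast]

/-- Subordination after multiplication of the symbol by a Gaussian factor, which makes Fubini's
theorem applicable. -/
theorem integral_cexp_mul_gauss_mul_exp_neg_rpow [NeZero n] {s T ε : ℝ} (hs0 : 0 < s)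
    (hs : s < 1 / 2) (hT : 0 < T) (hε : 0 < ε) (z : EuclideanSpace ℝ (Fin n)) :
    ∫ ξ : EuclideanSpace ℝ (Fin n), Complex.exp (Complex.I * ((inner ℝ z ξ : ℝ) : ℂ)) *
        ((Real.exp (-(ε * ‖ξ‖ ^ 2)) * Real.exp (-(T * ‖ξ‖ ^ 2) ^ s) : ℝ) : ℂ) =
      ((∫ u in Set.Ioi (0 : ℝ), stableDensity s u *
        ((Real.pi / (ε + T * u)) ^ (n / 2 : ℝ) *
          Real.exp (-(‖z‖ ^ 2 / (4 * (ε + T * u))))) : ℝ) : ℂ) := by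
  let f : EuclideanSpace ℝ (Fin n) → ℝ → ℂ := fun ξ u =>
    Complex.exp (Complex.I * ((inner ℝ z ξ : ℝ) : ℂ)) *
      ((Real.exp (-(ε * ‖ξ‖ ^ 2)) * (Real.exp (-(T * ‖ξ‖ ^ 2 * u)) * stableDensity s u) : ℝ) : ℂ)
  have hint : Integrable (Function.uncurry f) (volume.prod (volume.restrict (Set.Ioi 0))) := by
    have hm := measurable_stableDensity hs0
    have hmeas : Measurable (Function.uncurry f) := by
      unfold Function.uncurry f
      fun_prop
    refine Integrable.mono' ((integrable_exp_neg_mul_norm_sq hε).mul_prod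
      (integrableOn_stableDensity hs0 hs).norm) hmeas.aestronglyMeasurable ?_
    have hpos : ∀ᵐ p : EuclideanSpace ℝ (Fin n) × ℝ ∂(volume.prod (volume.restrict (Set.Ioi 0))),
        0 < p.2 := by
      have h0 : ∀ᵐ u : ℝ ∂(volume.restrict (Set.Ioi 0)), 0 < u := ae_restrict_mem measurableSet_Ioi
      exact Measure.quasiMeasurePreserving_snd.ae h0
    filter_upwards [hpos] with p hp
    simp only [Function.uncurry, f, norm_mul, norm_cexp_I_mul_inner, Complex.norm_real,
      Real.norm_of_nonneg (Real.exp_pos _).le, one_mul]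
    gcongr
    refine mul_le_of_le_one_left (norm_nonneg _) ?_
    rw [Real.exp_le_one_iff]
    have : 0 ≤ T * ‖p.1‖ ^ 2 * p.2 := by positivity
    linarith
  have h1 : ∀ᵐ ξ : EuclideanSpace ℝ (Fin n), (∫ u in Set.Ioi (0 : ℝ), f ξ u) =
      Complex.exp (Complex.I * ((inner ℝ z ξ : ℝ) : ℂ)) *
        ((Real.exp (-(ε * ‖ξ‖ ^ 2)) * Real.exp (-(T * ‖ξ‖ ^ 2) ^ s) : ℝ) : ℂ) := by
    filter_upwards [compl_mem_ae_iff.2 (measure_singleton (0 : EuclideanSpace ℝ (Fin n)))] with ξ hξ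
    have hξ' : 0 < ‖ξ‖ := norm_pos_iff.2 hξ
    simp only [f]
    rw [integral_const_mul, integral_complex_ofReal, integral_const_mul,
      integral_exp_neg_mul_stableDensity hs0 hs (by positivity)]
  have h2 : ∀ u ∈ Set.Ioi (0 : ℝ), (∫ ξ, f ξ u) = ((stableDensity s u *
        ((Real.pi / (ε + T * u)) ^ (n / 2 : ℝ) *
          Real.exp (-(‖z‖ ^ 2 / (4 * (ε + T * u))))) : ℝ) : ℂ) := by
    intro u hu
    have hu : 0 < u := hu
    have := integral_cexp_mul_exp_neg_mul_norm_sq (by positivity : 0 < ε + T * u) z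
    rw [Complex.ofReal_mul, ← this, ← integral_const_mul]
    refine integral_congr_ae (Eventually.of_forall fun ξ => ?_)
    simp only [f]
    have e : Real.exp (-((ε + T * u) * ‖ξ‖ ^ 2)) =
        Real.exp (-(ε * ‖ξ‖ ^ 2)) * Real.exp (-(T * ‖ξ‖ ^ 2 * u)) := by
      rw [← Real.exp_add]; ring_nf
    rw [e]
    push_cast
    ring
  rw [← integral_congr_ae h1, integral_integral_swap hint,
    setIntegral_congr_fun measurableSet_Ioi h2, integral_complex_ofReal]

/-- Bochner's subordination formula off the origin: the fractional heat kernel is a mixture of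
Gaussian heat kernels. -/
theorem fracHeatKernel_eq_integral_gaussKernel [NeZero n] {s t : ℝ} (hs0 : 0 < s) (hs : s < 1 / 2)
    (ht : 0 < t) {z : EuclideanSpace ℝ (Fin n)} (hz : z ≠ 0) :
    fracHeatKernel s z t =
      ∫ u in Set.Ioi (0 : ℝ), stableDensity s u * gaussKernel z (t ^ (1 / s) * u) := by
  have hpi := Real.pi_pos
  set T := t ^ (1 / s) with hTdef
  have hT : 0 < T := Real.rpow_pos_of_pos ht _
  have hzn : 0 < ‖z‖ := norm_pos_iff.2 hz
  have hn : (0 : ℝ) < n := by exact_mod_cast Nat.pos_of_ne_zero (NeZero.ne n)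
  have hsym : ∀ ξ : EuclideanSpace ℝ (Fin n), Real.exp (-(T * ‖ξ‖ ^ 2) ^ s) =
      Real.exp (-t * ‖ξ‖ ^ (2 * s)) := by
    intro ξ
    rw [Real.mul_rpow hT.le (by positivity), hTdef, ← Real.rpow_mul ht.le, one_div,
      inv_mul_cancel₀ hs0.ne', Real.rpow_one, ← Real.rpow_natCast, ← Real.rpow_mul (norm_nonneg _),
      neg_mul]
    rfl
  have hsymInt := integrable_exp_neg_mul_norm_rpow (n := n) ht (by linarith : 0 < 2 * s)
  have hL : Tendsto (fun ε : ℝ => ∫ ξ : EuclideanSpace ℝ (Fin n),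
      Complex.exp (Complex.I * ((inner ℝ z ξ : ℝ) : ℂ)) *
        ((Real.exp (-(ε * ‖ξ‖ ^ 2)) * Real.exp (-(T * ‖ξ‖ ^ 2) ^ s) : ℝ) : ℂ)) (𝓝[>] 0)
      (𝓝 (∫ ξ : EuclideanSpace ℝ (Fin n), Complex.exp (Complex.I * ((inner ℝ z ξ : ℝ) : ℂ)) *
        ((Real.exp (-t * ‖ξ‖ ^ (2 * s)) : ℝ) : ℂ))) := by
    simp_rw [hsym]
    refine tendsto_integral_filter_of_dominated_convergence
      (fun ξ => Real.exp (-t * ‖ξ‖ ^ (2 * s))) ?_ ?_ hsymInt ?_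
    · refine Eventually.of_forall fun ε => Measurable.aestronglyMeasurable ?_
      fun_prop
    · filter_upwards [self_mem_nhdsWithin] with ε hε
      have hε : 0 < ε := hε
      refine Eventually.of_forall fun ξ => ?_
      simp only [norm_mul, norm_cexp_I_mul_inner, Complex.norm_real,
        Real.norm_of_nonneg (Real.exp_pos _).le, one_mul]
      refine mul_le_of_le_one_left (Real.exp_pos _).le ?_
      rw [Real.exp_le_one_iff]
      have : 0 ≤ ε * ‖ξ‖ ^ 2 := by positivity
      linarith
    · refine Eventually.of_forall fun ξ => Tendsto.mono_left ?_ nhdsWithin_le_nhds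
      have hc : Continuous fun ε : ℝ => Complex.exp (Complex.I * ((inner ℝ z ξ : ℝ) : ℂ)) *
        ((Real.exp (-(ε * ‖ξ‖ ^ 2)) * Real.exp (-t * ‖ξ‖ ^ (2 * s)) : ℝ) : ℂ) := by
        fun_prop
      have := hc.tendsto 0
      simpa using this
  have hR : Tendsto (fun ε : ℝ => ((∫ u in Set.Ioi (0 : ℝ), stableDensity s u *
        ((Real.pi / (ε + T * u)) ^ (n / 2 : ℝ) *
          Real.exp (-(‖z‖ ^ 2 / (4 * (ε + T * u))))) : ℝ) : ℂ)) (𝓝[>] 0)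
      (𝓝 ((∫ u in Set.Ioi (0 : ℝ), stableDensity s u *
        ((Real.pi / (T * u)) ^ (n / 2 : ℝ) *
          Real.exp (-(‖z‖ ^ 2 / (4 * (T * u))))) : ℝ) : ℂ)) := by
    refine (Complex.continuous_ofReal.tendsto _).comp ?_
    have hm := measurable_stableDensity hs0
    refine tendsto_integral_filter_of_dominated_convergence
      (fun u => ‖stableDensity s u‖ * ((n / 2 : ℝ) / (‖z‖ ^ 2 / (4 * Real.pi))) ^ (n / 2 : ℝ)) ?_ ?_
      ((integrableOn_stableDensity hs0 hs).norm.mul_const _) ?_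
    · refine Eventually.of_forall fun ε => Measurable.aestronglyMeasurable ?_
      fun_prop
    · filter_upwards [self_mem_nhdsWithin] with ε hε
      have hε : 0 < ε := hε
      filter_upwards [ae_restrict_mem measurableSet_Ioi] with u hu
      have hu : 0 < u := hu
      have hv : 0 < ε + T * u := by positivity
      rw [norm_mul]
      gcongr
      rw [Real.norm_of_nonneg (by positivity)]
      have e : ‖z‖ ^ 2 / (4 * (ε + T * u)) =
          ‖z‖ ^ 2 / (4 * Real.pi) * (Real.pi / (ε + T * u)) := by
        field_simp
      rw [e]
      exact rpow_mul_exp_neg_le (by positivity) (by positivity) (by positivity)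
    · filter_upwards [ae_restrict_mem measurableSet_Ioi] with u hu
      have hu : 0 < u := hu
      have hTu : T * u ≠ 0 := by positivity
      refine Tendsto.mono_left ?_ nhdsWithin_le_nhds
      have hid : Tendsto (fun ε : ℝ => ε + T * u) (𝓝 0) (𝓝 (T * u)) := by
        have := (continuous_add_const (T * u)).tendsto (0 : ℝ)
        simpa using this
      refine Tendsto.const_mul _ (Tendsto.mul ?_ ?_)
      · exact (tendsto_const_nhds.div hid hTu).rpow_const (Or.inl (by positivity))
      · refine (Real.continuous_exp.tendsto _).comp
            ((tendsto_const_nhds.div (hid.const_mul 4) ?_).neg)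
        positivity
  have heq := tendsto_nhds_unique hL (hR.congr' (by
    filter_upwards [self_mem_nhdsWithin] with ε hε
    exact (integral_cexp_mul_gauss_mul_exp_neg_rpow hs0 hs hT hε z).symm))
  rw [fracHeatKernel, heq, Complex.ofReal_re, ← integral_const_mul]
  refine setIntegral_congr_fun measurableSet_Ioi fun u hu => ?_
  have hu : 0 < u := hu
  simp only [gaussKernel]
  rw [← two_pi_pow_mul_rpow (by positivity : 0 < T * u)]
  ring

/-- The value of `C_{n,s}` in terms of the Gamma function. -/
noncomputable def rieszConst (n : ℕ) (s : ℝ) : ℝ :=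
  stableConst s * ((4 * Real.pi) ^ (-(n / 2 : ℝ)) * 4 ^ (s + n / 2 : ℝ) * Real.Gamma (s + n / 2))

theorem rpow_mul_gaussKernel_eq (s : ℝ) (z : EuclideanSpace ℝ (Fin n)) {v : ℝ} (hv : 0 < v) :
    v ^ (-1 - s) * gaussKernel z v = (4 * Real.pi) ^ (-(n / 2 : ℝ)) *
      (v ^ (-1 - s - n / 2 : ℝ) * Real.exp (-(‖z‖ ^ 2 / 4 * v⁻¹))) := by
  have hpi := Real.pi_pos
  rw [gaussKernel, Real.mul_rpow (by positivity) hv.le, sub_eq_add_neg (-1 - s) (n / 2 : ℝ),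
    Real.rpow_add hv]
  have : ‖z‖ ^ 2 / (4 * v) = ‖z‖ ^ 2 / 4 * v⁻¹ := by field_simp
  rw [this]
  ring

theorem inv_substitution_gamma {a b w : ℝ} (hw : 0 < w) :
    (|(-1 : ℝ)| * w ^ ((-1 : ℝ) - 1)) • ((w ^ (-1 : ℝ)) ^ (-1 - a) *
        Real.exp (-(b * (w ^ (-1 : ℝ))⁻¹))) =
      w ^ (a - 1) * Real.exp (-(b * w)) := by
  have e1 : w ^ ((-1 : ℝ) - 1) * (w ^ (-1 : ℝ)) ^ (-1 - a) = w ^ (a - 1) := by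
    rw [← Real.rpow_mul hw.le, ← Real.rpow_add hw]
    congr 1; ring
  have e2 : (w ^ (-1 : ℝ))⁻¹ = w := by rw [Real.rpow_neg_one, inv_inv]
  rw [e2, abs_neg, abs_one, one_mul, smul_eq_mul, ← mul_assoc, e1]

theorem integrableOn_rpow_mul_exp_neg_mul_inv {a b : ℝ} (ha : 0 < a) (hb : 0 < b) :
    IntegrableOn (fun v => v ^ (-1 - a) * Real.exp (-(b * v⁻¹))) (Set.Ioi 0) := by
  rw [← integrableOn_Ioi_comp_rpow_iff _ (by norm_num : (-1 : ℝ) ≠ 0)]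
  refine (integrableOn_rpow_mul_exp_neg_mul (by linarith : -1 < a - 1) hb).congr_fun
    (fun w hw => ?_) measurableSet_Ioi
  exact (inv_substitution_gamma hw).symm

theorem integral_rpow_mul_exp_neg_mul_inv {a b : ℝ} (ha : 0 < a) (hb : 0 < b) :
    ∫ v in Set.Ioi (0 : ℝ), v ^ (-1 - a) * Real.exp (-(b * v⁻¹)) = (1 / b) ^ a * Real.Gamma a := by
  rw [← integral_comp_rpow_Ioi _ (by norm_num : (-1 : ℝ) ≠ 0),
    ← Real.integral_rpow_mul_exp_neg_mul_Ioi ha hb]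
  exact setIntegral_congr_fun measurableSet_Ioi fun w hw => inv_substitution_gamma hw

theorem integrableOn_rpow_mul_gaussKernel {s : ℝ} (hs0 : 0 < s) {z : EuclideanSpace ℝ (Fin n)}
    (hz : z ≠ 0) : IntegrableOn (fun v => v ^ (-1 - s) * gaussKernel z v) (Set.Ioi 0) := by
  have hzn : 0 < ‖z‖ := norm_pos_iff.2 hz
  have h : IntegrableOn _ (Set.Ioi (0 : ℝ)) :=
    (integrableOn_rpow_mul_exp_neg_mul_inv (a := s + n / 2) (b := ‖z‖ ^ 2 / 4) (by positivity)
      (by positivity)).const_mul ((4 * Real.pi) ^ (-(n / 2 : ℝ)))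
  refine h.congr_fun (fun v hv => ?_) measurableSet_Ioi
  simp only
  rw [rpow_mul_gaussKernel_eq s z hv, ← sub_sub]

/-- The Riesz-type kernel `|z| ^ (-n - 2s)` as a superposition of Gaussian heat kernels. -/
theorem integral_stableConst_mul_gaussKernel {s : ℝ} (hs0 : 0 < s)
    {z : EuclideanSpace ℝ (Fin n)} (hz : z ≠ 0) :
    ∫ v in Set.Ioi (0 : ℝ), stableConst s * (v ^ (-1 - s) * gaussKernel z v) =
      rieszConst n s * (1 / ‖z‖ ^ ((n : ℝ) + 2 * s)) := by
  have hzn : 0 < ‖z‖ := norm_pos_iff.2 hz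
  rw [integral_const_mul, setIntegral_congr_fun measurableSet_Ioi fun v hv =>
    rpow_mul_gaussKernel_eq s z hv, integral_const_mul]
  have h := integral_rpow_mul_exp_neg_mul_inv (a := s + n / 2) (b := ‖z‖ ^ 2 / 4) (by positivity)
    (by positivity)
  rw [← sub_sub] at h
  rw [h, rieszConst]
  have e : (1 / (‖z‖ ^ 2 / 4)) ^ (s + n / 2 : ℝ) = 4 ^ (s + n / 2 : ℝ) *
      (1 / ‖z‖ ^ ((n : ℝ) + 2 * s)) := by
    have e1 : (1 / (‖z‖ ^ 2 / 4)) = 4 * (‖z‖ ^ 2)⁻¹ := by field_simp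
    rw [e1, Real.mul_rpow (by norm_num) (by positivity), Real.inv_rpow (by positivity), one_div,
      ← Real.rpow_natCast, ← Real.rpow_mul hzn.le]
    congr 3
    push_cast; ring
  rw [e]
  ring

/-- The rescaled kernel `P^s(z, t) / t`, after the substitution `v = t ^ (1 / s) * u`. -/
theorem fracHeatKernel_div_eq [NeZero n] {s t : ℝ} (hs0 : 0 < s) (hs : s < 1 / 2)
    (ht : 0 < t) {z : EuclideanSpace ℝ (Fin n)} (hz : z ≠ 0) :
    fracHeatKernel s z t / t = ∫ v in Set.Ioi (0 : ℝ),
      ((v / t ^ (1 / s)) ^ (1 + s) * stableDensity s (v / t ^ (1 / s))) *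
        (v ^ (-1 - s) * gaussKernel z v) := by
  rw [fracHeatKernel_eq_integral_gaussKernel hs0 hs ht hz]
  set T := t ^ (1 / s) with hTdef
  have hT : 0 < T := Real.rpow_pos_of_pos ht _
  have hTs : T ^ (1 + s) = T * t := by
    rw [Real.rpow_add hT, Real.rpow_one, hTdef, ← Real.rpow_mul ht.le (1 / s) s, one_div,
      inv_mul_cancel₀ hs0.ne', Real.rpow_one]
  have h := integral_comp_mul_left_Ioi (fun v => stableDensity s (v / T) * gaussKernel z v) 0 hT
  simp only [mul_div_cancel_left₀ _ hT.ne', mul_zero, smul_eq_mul] at h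
  rw [h, inv_mul_eq_div, div_div, ← hTs, div_eq_inv_mul, ← integral_const_mul]
  refine setIntegral_congr_fun measurableSet_Ioi fun v hv => ?_
  have hv : 0 < v := hv
  rw [Real.div_rpow hv.le hT.le, sub_eq_add_neg, ← neg_add, Real.rpow_neg hv.le]
  have := Real.rpow_pos_of_pos hv (1 + s)
  have := Real.rpow_pos_of_pos hT (1 + s)
  field_simp

theorem abs_rpow_mul_stableDensity_le {s u : ℝ} (hs0 : 0 < s) (hs : s < 1 / 2) (hu : 0 < u) :
    |u ^ (1 + s) * stableDensity s u| ≤ stableConst s := by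
  have h := abs_stableDensity_le_rpow hs0 hs hu
  have hp := Real.rpow_pos_of_pos hu (1 + s)
  rw [abs_mul, abs_of_pos hp]
  have e : u ^ (1 + s) * u ^ (-1 - s) = 1 := by
    rw [← Real.rpow_add hu]; simp
  calc _ ≤ u ^ (1 + s) * (stableConst s * u ^ (-1 - s)) := by gcongr
    _ = _ := by rw [mul_left_comm, e, mul_one]

theorem fracHeatKernel_div_le [NeZero n] {s t : ℝ} (hs0 : 0 < s) (hs : s < 1 / 2)
    (ht : 0 < t) {z : EuclideanSpace ℝ (Fin n)} (hz : z ≠ 0) :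
    fracHeatKernel s z t / t ≤ rieszConst n s * (1 / ‖z‖ ^ ((n : ℝ) + 2 * s)) := by
  rw [fracHeatKernel_div_eq hs0 hs ht hz, ← integral_stableConst_mul_gaussKernel hs0 hz]
  refine (le_abs_self _).trans ?_
  rw [← Real.norm_eq_abs]
  refine norm_integral_le_of_norm_le ((integrableOn_rpow_mul_gaussKernel hs0 hz).const_mul _) ?_
  filter_upwards [ae_restrict_mem measurableSet_Ioi] with v hv
  have hv : 0 < v := hv
  have h2 := gaussKernel_nonneg z hv.le
  rw [norm_mul, Real.norm_of_nonneg (by positivity : 0 ≤ v ^ (-1 - s) * gaussKernel z v)]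
  gcongr
  exact abs_rpow_mul_stableDensity_le hs0 hs (by positivity)

/-- The small-time asymptotics of the fractional heat kernel. -/
theorem tendsto_fracHeatKernel_div [NeZero n] {s : ℝ} (hs0 : 0 < s) (hs : s < 1 / 2)
    {z : EuclideanSpace ℝ (Fin n)} (hz : z ≠ 0) :
    Tendsto (fun t => fracHeatKernel s z t / t) (𝓝[>] 0)
      (𝓝 (rieszConst n s * (1 / ‖z‖ ^ ((n : ℝ) + 2 * s)))) := by
  rw [← integral_stableConst_mul_gaussKernel hs0 hz]
  have hcongr : (fun t => ∫ v in Set.Ioi (0 : ℝ),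
      ((v / t ^ (1 / s)) ^ (1 + s) * stableDensity s (v / t ^ (1 / s))) *
        (v ^ (-1 - s) * gaussKernel z v)) =ᶠ[𝓝[>] 0] fun t => fracHeatKernel s z t / t := by
    filter_upwards [self_mem_nhdsWithin] with t ht
    exact (fracHeatKernel_div_eq hs0 hs ht hz).symm
  refine Tendsto.congr' hcongr ?_
  refine tendsto_integral_filter_of_dominated_convergence
    (fun v => stableConst s * (v ^ (-1 - s) * gaussKernel z v)) ?_ ?_
    ((integrableOn_rpow_mul_gaussKernel hs0 hz).const_mul _) ?_
  · refine Eventually.of_forall fun t => Measurable.aestronglyMeasurable ?_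
    have h1 := measurable_stableDensity hs0
    have h2 : Measurable (gaussKernel z) := measurable_gaussKernel.of_uncurry_left
    fun_prop
  · filter_upwards [self_mem_nhdsWithin] with t ht
    have ht : 0 < t := ht
    filter_upwards [ae_restrict_mem measurableSet_Ioi] with v hv
    have hv : 0 < v := hv
    have h2 := gaussKernel_nonneg z hv.le
    rw [norm_mul, Real.norm_of_nonneg (by positivity : 0 ≤ v ^ (-1 - s) * gaussKernel z v)]
    gcongr
    exact abs_rpow_mul_stableDensity_le hs0 hs (by positivity)
  · filter_upwards [ae_restrict_mem measurableSet_Ioi] with v hv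
    have hv : 0 < v := hv
    refine Tendsto.mul_const _ ((tendsto_rpow_mul_stableDensity hs0 hs).comp ?_)
    have h1 : Tendsto (fun t : ℝ => t ^ (1 / s)) (𝓝[>] 0) (𝓝[>] 0) := by
      refine tendsto_nhdsWithin_iff.2 ⟨?_, ?_⟩
      · have h0 : Tendsto (fun t : ℝ => t) (𝓝[>] 0) (𝓝 0) := nhdsWithin_le_nhds
        have := h0.rpow_const (p := 1 / s) (Or.inr (by positivity))
        rwa [Real.zero_rpow (by positivity)] at this
      · filter_upwards [self_mem_nhdsWithin] with t ht
        exact Real.rpow_pos_of_pos ht _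
    have h2 := (tendsto_inv_nhdsGT_zero.comp h1).const_mul_atTop hv
    exact h2

end

/-! ### The normalising constant -/

section

theorem one_sub_exp_neg_le {v : ℝ} : 1 - Real.exp (-v) ≤ v := by
  linarith [Real.add_one_le_exp (-v)]

theorem one_sub_exp_neg_nonneg {v : ℝ} (hv : 0 ≤ v) : 0 ≤ 1 - Real.exp (-v) := by
  linarith [Real.exp_le_one_iff.2 (neg_nonpos.2 hv)]

theorem integrableOn_one_sub_exp_mul_rpow {s : ℝ} (hs0 : 0 < s) (hs1 : s < 1) :
    IntegrableOn (fun v => (1 - Real.exp (-v)) * v ^ (-1 - s)) (Set.Ioi 0) := by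
  have hm : Measurable fun v : ℝ => (1 - Real.exp (-v)) * v ^ (-1 - s) := by fun_prop
  rw [← Set.Ioc_union_Ioi_eq_Ioi zero_le_one]
  refine IntegrableOn.union ?_ ?_
  · have h := (intervalIntegral.intervalIntegrable_rpow' (a := 0) (b := 1) (by linarith : -1 < -s))
    rw [intervalIntegrable_iff_integrableOn_Ioc_of_le zero_le_one] at h
    refine Integrable.mono' h hm.aestronglyMeasurable ?_
    filter_upwards [ae_restrict_mem measurableSet_Ioc] with v hv
    have hv0 := hv.1
    have h1 := one_sub_exp_neg_nonneg hv0.le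
    rw [Real.norm_of_nonneg (by positivity)]
    calc _ ≤ v * v ^ (-1 - s) := by gcongr; exact one_sub_exp_neg_le
      _ = v ^ (-s) := by
        rw [← Real.rpow_one_add' hv0.le (by linarith)]
        congr 1; ring
  · refine Integrable.mono' (integrableOn_Ioi_rpow_of_lt (a := -1 - s) (by linarith) one_pos)
      hm.aestronglyMeasurable ?_
    filter_upwards [ae_restrict_mem measurableSet_Ioi] with v hv
    have hv0 : 0 < v := lt_trans one_pos hv
    have h1 := one_sub_exp_neg_nonneg hv0.le
    rw [Real.norm_of_nonneg (by positivity)]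
    refine mul_le_of_le_one_left (by positivity) ?_
    linarith [Real.exp_pos (-v)]

theorem integral_one_sub_exp_mul_rpow {s : ℝ} (hs0 : 0 < s) (hs1 : s < 1) :
    ∫ v in Set.Ioi (0 : ℝ), (1 - Real.exp (-v)) * v ^ (-1 - s) = Real.Gamma (1 - s) / s := by
  have hΓ : IntegrableOn (fun v => Real.exp (-v) * (-v ^ (-s) / s)) (Set.Ioi 0) := by
    have h := (Real.GammaIntegral_convergent (s := 1 - s) (by linarith)).const_mul (-1 / s)
    refine IntegrableOn.congr_fun h (fun v _ => ?_) measurableSet_Ioi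
    rw [show (1 - s - 1 : ℝ) = -s by ring]
    ring
  have hparts := integral_Ioi_mul_deriv_eq_deriv_mul (a := (0 : ℝ)) (a' := (0 : ℝ)) (b' := (0 : ℝ))
    (u := fun v => 1 - Real.exp (-v)) (u' := fun v => Real.exp (-v))
    (v := fun v => -v ^ (-s) / s) (v' := fun v => v ^ (-1 - s)) ?_ ?_
    (integrableOn_one_sub_exp_mul_rpow hs0 hs1) hΓ ?_ ?_
  · rw [hparts, Real.Gamma_eq_integral (by linarith), ← integral_div, sub_zero, zero_sub,
      ← integral_neg]
    refine setIntegral_congr_fun measurableSet_Ioi fun v _ => ?_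
    rw [show (1 - s - 1 : ℝ) = -s by ring]
    ring
  · intro v _
    have := ((hasDerivAt_id v).neg.exp).const_sub 1
    simpa using this
  · intro v hv
    have hv : (0 : ℝ) < v := hv
    have := ((Real.hasDerivAt_rpow_const (p := -s) (Or.inl hv.ne')).fun_neg).div_const s
    convert this using 1
    rw [show (-s - 1 : ℝ) = -1 - s by ring]
    field_simp
  · refine squeeze_zero_norm' (a := fun v : ℝ => v ^ (1 - s) / s) ?_ ?_
    · filter_upwards [self_mem_nhdsWithin] with v hv
      have hv : (0 : ℝ) < v := hv
      simp only [Pi.mul_apply]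
      have h1 := one_sub_exp_neg_nonneg hv.le
      have h2 := Real.rpow_pos_of_pos hv (-s)
      rw [norm_mul, norm_div, norm_neg, Real.norm_of_nonneg h1, Real.norm_of_nonneg h2.le,
        Real.norm_of_nonneg hs0.le, sub_eq_add_neg 1 s, Real.rpow_add hv, Real.rpow_one,
            mul_div_assoc]
      gcongr
      exact one_sub_exp_neg_le
    · have h0 : Tendsto (fun t : ℝ => t) (𝓝[>] 0) (𝓝 0) := nhdsWithin_le_nhds
      have := (h0.rpow_const (p := 1 - s) (Or.inr (by linarith))).div_const s
      rwa [Real.zero_rpow (by linarith), zero_div] at this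
  · have h1 : Tendsto (fun v : ℝ => 1 - Real.exp (-v)) atTop (𝓝 (1 - 0)) :=
      tendsto_const_nhds.sub Real.tendsto_exp_neg_atTop_nhds_zero
    have h2 := ((tendsto_rpow_neg_atTop hs0).neg).div_const s
    rw [neg_zero, zero_div] at h2
    have h3 := h1.mul h2
    rwa [mul_zero] at h3

/-- The Lévy measure of the stable subordinator is normalised to have exponent `1` at `1`. -/
theorem stableConst_mul_Gamma_div {s : ℝ} (hs0 : 0 < s) (hs : s < 1 / 2) :
    stableConst s * (Real.Gamma (1 - s) / s) = 1 := by
  have h := Real.Gamma_mul_Gamma_one_sub s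
  have hd := sin_pi_mul_pos hs0 hs
  have hpi := Real.pi_pos
  rw [stableConst, Real.Gamma_add_one hs0.ne']
  rw [eq_div_iff hd.ne'] at h
  field_simp
  linarith

variable {n : ℕ}

theorem integrable_one_sub_cos_mul_gaussKernel [NeZero n] {v : ℝ} (hv : 0 < v) :
    Integrable fun h : EuclideanSpace ℝ (Fin n) => (1 - Real.cos (h 0)) * gaussKernel h v := by
  have hb : 0 < 1 / (4 * v) := by positivity
  have hg : Integrable fun h : EuclideanSpace ℝ (Fin n) => gaussKernel h v := by
    refine ((integrable_exp_neg_mul_norm_sq (n := n) hb).const_mul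
      ((4 * Real.pi * v) ^ (-(n / 2 : ℝ)))).congr (Eventually.of_forall fun h => ?_)
    simp only [gaussKernel]
    ring_nf
  refine hg.bdd_mul (c := 2) (Continuous.aestronglyMeasurable (by fun_prop))
    (Eventually.of_forall fun h => ?_)
  have := Real.neg_one_le_cos (h 0)
  have := Real.cos_le_one (h 0)
  rw [Real.norm_eq_abs, abs_le]
  constructor <;> linarith

/-- The characteristic function of the Gaussian of variance `2v`, at a unit frequency. -/
theorem integral_one_sub_cos_mul_gaussKernel [NeZero n] {v : ℝ} (hv : 0 < v) :
    ∫ h : EuclideanSpace ℝ (Fin n), (1 - Real.cos (h 0)) * gaussKernel h v = 1 - Real.exp (-v) := by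
  have hpi := Real.pi_pos
  have hb : 0 < 1 / (4 * v) := by positivity
  have hint := integrable_exp_neg_mul_norm_sq (n := n) hb
  have hre : ∀ z : EuclideanSpace ℝ (Fin n), ∫ h : EuclideanSpace ℝ (Fin n),
      Real.cos (inner ℝ z h) * Real.exp (-(1 / (4 * v) * ‖h‖ ^ 2)) =
        (Real.pi / (1 / (4 * v))) ^ (n / 2 : ℝ) * Real.exp (-(‖z‖ ^ 2 / (4 * (1 / (4 * v))))) := by
    intro z
    have h1 := integral_cexp_mul_exp_neg_mul_norm_sq hb z
    have h2 := integral_re (integrable_cexp_mul_of_integrable hint z)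
    rw [h1] at h2
    rw [RCLike.re_eq_complex_re, Complex.ofReal_re] at h2
    rw [← h2]
    refine integral_congr_ae (Eventually.of_forall fun h => ?_)
    beta_reduce
    rw [Complex.re_mul_ofReal, mul_comm Complex.I, Complex.exp_ofReal_mul_I_re]
  have h0 := hre 0
  have h1 := hre (EuclideanSpace.single 0 1)
  simp only [inner_zero_left, Real.cos_zero, one_mul, norm_zero] at h0
  simp only [EuclideanSpace.inner_single_left, map_one, one_mul, PiLp.norm_single, norm_one] at h1
  have hcos : Integrable fun h : EuclideanSpace ℝ (Fin n) =>
      Real.cos (h 0) * Real.exp (-(1 / (4 * v) * ‖h‖ ^ 2)) := by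
    refine hint.bdd_mul (c := 1) (Continuous.aestronglyMeasurable (by fun_prop))
      (Eventually.of_forall fun h => ?_)
    rw [Real.norm_eq_abs]
    exact Real.abs_cos_le_one _
  have hform : ∀ h : EuclideanSpace ℝ (Fin n), (1 - Real.cos (h 0)) * gaussKernel h v =
      (4 * Real.pi * v) ^ (-(n / 2 : ℝ)) * (Real.exp (-(1 / (4 * v) * ‖h‖ ^ 2)) -
        Real.cos (h 0) * Real.exp (-(1 / (4 * v) * ‖h‖ ^ 2))) := by
    intro h
    rw [gaussKernel, show ‖h‖ ^ 2 / (4 * v) = 1 / (4 * v) * ‖h‖ ^ 2 by ring]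
    ring
  simp_rw [hform]
  rw [integral_const_mul, integral_sub hint hcos, h0, h1]
  have e1 : Real.pi / (1 / (4 * v)) = 4 * Real.pi * v := by field_simp
  have e2 : (1 : ℝ) ^ 2 / (4 * (1 / (4 * v))) = v := by field_simp
  have e3 : (4 * Real.pi * v) ^ (-(n / 2 : ℝ)) * (4 * Real.pi * v) ^ (n / 2 : ℝ) = 1 := by
    rw [← Real.rpow_add (by positivity)]; simp
  rw [e1, e2]
  simp only [ne_eq, OfNat.ofNat_ne_zero, not_false_eq_true, zero_pow, zero_div, neg_zero,
      Real.exp_zero, mul_one]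
  linear_combination (1 - Real.exp (-v)) * e3

theorem rieszConst_pos {s : ℝ} (hs0 : 0 < s) (hs : s < 1 / 2) : 0 < rieszConst n s := by
  have h1 := stableConst_pos hs0 hs
  have h2 := Real.Gamma_pos_of_pos (by positivity : 0 < s + n / 2)
  have := Real.pi_pos
  unfold rieszConst
  positivity

theorem lintegral_rieszConst_mul [NeZero n] {s : ℝ} (hs0 : 0 < s) (hs : s < 1 / 2) :
    ∫⁻ h : EuclideanSpace ℝ (Fin n), ENNReal.ofReal ((1 - Real.cos (h 0)) *
      (rieszConst n s * (1 / ‖h‖ ^ ((n : ℝ) + 2 * s)))) = 1 := by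
  have hκ := stableConst_pos hs0 hs
  have hcos : ∀ h : EuclideanSpace ℝ (Fin n), 0 ≤ 1 - Real.cos (h 0) := fun h =>
    sub_nonneg.2 (Real.cos_le_one _)
  have hG : Measurable fun p : EuclideanSpace ℝ (Fin n) × ℝ => gaussKernel p.1 p.2 :=
    measurable_gaussKernel
  have h1 : ∀ᵐ h : EuclideanSpace ℝ (Fin n), ENNReal.ofReal ((1 - Real.cos (h 0)) *
      (rieszConst n s * (1 / ‖h‖ ^ ((n : ℝ) + 2 * s)))) = ∫⁻ v in Set.Ioi (0 : ℝ),
        ENNReal.ofReal ((1 - Real.cos (h 0)) *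
            (stableConst s * (v ^ (-1 - s) * gaussKernel h v))) := by
    filter_upwards [compl_mem_ae_iff.2 (measure_singleton (0 : EuclideanSpace ℝ (Fin n)))] with h hh
    rw [← integral_stableConst_mul_gaussKernel hs0 hh, ← integral_const_mul,
      ofReal_integral_eq_lintegral_ofReal
        (((integrableOn_rpow_mul_gaussKernel hs0 hh).const_mul _).const_mul _)]
    filter_upwards [ae_restrict_mem measurableSet_Ioi] with v hv
    have hv : (0 : ℝ) < v := hv
    have h2 := gaussKernel_nonneg h hv.le
    have h3 := hcos h
    simp only [Pi.zero_apply]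
    positivity
  have h2 : ∀ v ∈ Set.Ioi (0 : ℝ), (∫⁻ h : EuclideanSpace ℝ (Fin n),
      ENNReal.ofReal ((1 - Real.cos (h 0)) * (stableConst s * (v ^ (-1 - s) * gaussKernel h v)))) =
        ENNReal.ofReal (stableConst s * ((1 - Real.exp (-v)) * v ^ (-1 - s))) := by
    intro v hv
    have hv : (0 : ℝ) < v := hv
    have e : stableConst s * ((1 - Real.exp (-v)) * v ^ (-1 - s)) =
        ∫ h : EuclideanSpace ℝ (Fin n), (stableConst s * v ^ (-1 - s)) *
          ((1 - Real.cos (h 0)) * gaussKernel h v) := by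
      rw [integral_const_mul, integral_one_sub_cos_mul_gaussKernel hv]; ring
    rw [e, ofReal_integral_eq_lintegral_ofReal
      ((integrable_one_sub_cos_mul_gaussKernel hv).const_mul _)]
    · refine lintegral_congr fun h => ?_
      congr 1; ring
    · refine Eventually.of_forall fun h => ?_
      have h2 := gaussKernel_nonneg h hv.le
      have h3 := hcos h
      simp only [Pi.zero_apply]
      positivity
  rw [lintegral_congr_ae h1, lintegral_lintegral_swap, setLIntegral_congr_fun measurableSet_Ioi h2,
    ← ofReal_integral_eq_lintegral_ofReal
      ((integrableOn_one_sub_exp_mul_rpow hs0 (by linarith)).const_mul _), integral_const_mul,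
    integral_one_sub_exp_mul_rpow hs0 (by linarith), stableConst_mul_Gamma_div hs0 hs,
    ENNReal.ofReal_one]
  · filter_upwards [ae_restrict_mem measurableSet_Ioi] with v hv
    have hv : (0 : ℝ) < v := hv
    have := one_sub_exp_neg_nonneg hv.le
    simp only [Pi.zero_apply]
    positivity
  · refine Measurable.aemeasurable ?_
    unfold Function.uncurry
    fun_prop

theorem fracLaplaceConst_eq [NeZero n] {s : ℝ} (hs0 : 0 < s) (hs : s < 1 / 2) :
    fracLaplaceConst n s = rieszConst n s := by
  have hA := rieszConst_pos (n := n) hs0 hs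
  have h1 : rieszConst n s * (∫ h : EuclideanSpace ℝ (Fin n),
      (1 - Real.cos (h 0)) / ‖h‖ ^ ((n : ℝ) + 2 * s)) = 1 := by
    rw [← integral_const_mul, integral_eq_lintegral_of_nonneg_ae]
    · refine (congrArg ENNReal.toReal ((lintegral_congr fun h => ?_).trans
        (lintegral_rieszConst_mul (n := n) hs0 hs))).trans ENNReal.toReal_one
      congr 1; ring
    · refine Eventually.of_forall fun h => ?_
      have := sub_nonneg.2 (Real.cos_le_one (h 0))
      simp only [Pi.zero_apply]
      positivity
    · refine Measurable.aestronglyMeasurable ?_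
      fun_prop
  rw [fracLaplaceConst]
  exact (eq_inv_of_mul_eq_one_left h1).symm

end

/-! ### Fatou's lemma for interaction energies -/

section

/-- The interaction energy `∫_E ∫_{Eᶜ} k (x - y) dy dx` of a kernel `k` on `ℝⁿ`. -/
noncomputable def kernelEnergy {n : ℕ} (k : EuclideanSpace ℝ (Fin n) → ENNReal)
    (E : Set (EuclideanSpace ℝ (Fin n))) : ENNReal :=
  ∫⁻ x in E, ∫⁻ y in Eᶜ, k (x - y)

variable {n : ℕ} {k : EuclideanSpace ℝ (Fin n) → ENNReal} {E F : Set (EuclideanSpace ℝ (Fin n))}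

theorem kernelEnergy_congr_set (h : E =ᵐ[volume] F) : kernelEnergy k E = kernelEnergy k F := by
  unfold kernelEnergy
  rw [Measure.restrict_congr_set h, Measure.restrict_congr_set h.compl]

theorem kernelEnergy_eq_lintegral_prod (hk : Measurable k) (E : Set (EuclideanSpace ℝ (Fin n))) :
    kernelEnergy k E = ∫⁻ p, k (p.1 - p.2) ∂((volume.restrict E).prod (volume.restrict Eᶜ)) := by
  exact (lintegral_prod _ (hk.comp (measurable_fst.sub measurable_snd)).aemeasurable).symm

theorem kernelEnergy_eq_lintegral_indicator (hk : Measurable k) (hE : MeasurableSet E) :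
    kernelEnergy k E = ∫⁻ p : EuclideanSpace ℝ (Fin n) × EuclideanSpace ℝ (Fin n),
      (E ×ˢ Eᶜ).indicator (fun p => k (p.1 - p.2)) p := by
  rw [kernelEnergy_eq_lintegral_prod hk, Measure.prod_restrict,
    lintegral_indicator (hE.prod hE.compl)]
  rfl

/-- Fatou's lemma for energies, when the sets converge almost everywhere. -/
theorem kernelEnergy_le_liminf_of_ae {K : ℕ → EuclideanSpace ℝ (Fin n) → ENNReal}
    (hk : Measurable k) (hK : ∀ i, Measurable (K i))
    (hlim : ∀ z, z ≠ 0 → Tendsto (fun i => K i z) atTop (𝓝 (k z)))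
    (hE : MeasurableSet E) {F : ℕ → Set (EuclideanSpace ℝ (Fin n))}
    (hF : ∀ i, MeasurableSet (F i))
    (hae : ∀ᵐ x, ∀ᶠ i in atTop, x ∈ F i ↔ x ∈ E) :
    kernelEnergy k E ≤ liminf (fun i => kernelEnergy (K i) (F i)) atTop := by
  rw [kernelEnergy_eq_lintegral_indicator hk hE]
  simp_rw [fun i => kernelEnergy_eq_lintegral_indicator (hK i) (hF i)]
  refine le_trans (lintegral_mono_ae ?_) (lintegral_liminf_le' fun i => ?_)
  · have h1 := Measure.quasiMeasurePreserving_fst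
        (μ := (volume : Measure (EuclideanSpace ℝ (Fin n))))
      (ν := (volume : Measure (EuclideanSpace ℝ (Fin n)))) |>.ae hae
    have h2 := Measure.quasiMeasurePreserving_snd
        (μ := (volume : Measure (EuclideanSpace ℝ (Fin n))))
      (ν := (volume : Measure (EuclideanSpace ℝ (Fin n)))) |>.ae hae
    filter_upwards [h1, h2] with p hp1 hp2
    by_cases hp : p ∈ E ×ˢ Eᶜ
    · have hne : p.1 - p.2 ≠ 0 := by
        intro h
        rw [sub_eq_zero] at h
        exact hp.2 (h ▸ hp.1)
      rw [Set.indicator_of_mem hp]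
      refine le_of_eq (Tendsto.liminf_eq ?_).symm
      refine (hlim _ hne).congr' ?_
      filter_upwards [hp1, hp2] with i hi1 hi2
      rw [Set.indicator_of_mem]
      exact ⟨hi1.2 hp.1, fun h => hp.2 (hi2.1 h)⟩
    · rw [Set.indicator_of_notMem hp]
      exact zero_le
  · exact (((hK i).comp (measurable_fst.sub measurable_snd)).indicator
      ((hF i).prod (hF i).compl)).aemeasurable

/-- The lower semicontinuity half of `Γ`-convergence: along a subsequence realising the lower limit
the sets may be taken to converge almost everywhere. -/
theorem kernelEnergy_le_liminf {K : ℕ → EuclideanSpace ℝ (Fin n) → ENNReal}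
    (hk : Measurable k) (hK : ∀ i, Measurable (K i))
    (hlim : ∀ z, z ≠ 0 → Tendsto (fun i => K i z) atTop (𝓝 (k z)))
    (hE : NullMeasurableSet E) {F : ℕ → Set (EuclideanSpace ℝ (Fin n))}
    (hF : ∀ i, NullMeasurableSet (F i)) (hFE : TendstoSetL1 F E) :
    kernelEnergy k E ≤ liminf (fun i => kernelEnergy (K i) (F i)) atTop := by
  by_contra! hcon
  obtain ⟨b, hb1, hb2⟩ := exists_between hcon
  obtain ⟨φ, hφ, hφb⟩ := extraction_of_frequently_atTop (frequently_lt_of_liminf_lt (h := hb1))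
  have hmeas : TendstoInMeasure volume
      (fun i => (F i).indicator (fun _ => (1 : ℝ))) atTop (E.indicator fun _ => (1 : ℝ)) := by
    refine tendstoInMeasure_of_tendsto_eLpNorm one_ne_zero (fun i => ?_) ?_ hFE
    · exact aestronglyMeasurable_const.indicator₀ (hF i)
    · exact aestronglyMeasurable_const.indicator₀ hE
  obtain ⟨ψ, hψ, hae⟩ := TendstoInMeasure.exists_seq_tendsto_ae
    (f := fun i => (F (φ i)).indicator (fun _ => (1 : ℝ))) (g := E.indicator fun _ => (1 : ℝ))
    (fun ε hε => (hmeas ε hε).comp hφ.tendsto_atTop)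
  obtain ⟨E', -, hE', hEE'⟩ := hE.exists_measurable_superset_ae_eq
  choose F' _ hF' hFF' using fun i => (hF i).exists_measurable_superset_ae_eq
  have key : kernelEnergy k E' ≤ liminf (fun i =>
      kernelEnergy (K (φ (ψ i))) (F' (φ (ψ i)))) atTop := by
    refine kernelEnergy_le_liminf_of_ae hk (fun i => hK _)
      (fun z hz => (hlim z hz).comp (hφ.comp hψ).tendsto_atTop) hE' (fun i => hF' _) ?_
    have hall : ∀ᵐ x, ∀ i, F' i x = F i x := ae_all_iff.2 hFF'
    filter_upwards [hae, hall, hEE'] with x hx hx2 hx3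
    have hx3' : (x ∈ E') = (x ∈ E) := hx3
    have hev := hx.eventually (Metric.ball_mem_nhds _ one_half_pos)
    filter_upwards [hev] with i hi
    have hx2' : (x ∈ F' (φ (ψ i))) = (x ∈ F (φ (ψ i))) := hx2 _
    rw [hx2', hx3']
    rw [Real.dist_eq] at hi
    by_cases h1 : x ∈ F (φ (ψ i)) <;> by_cases h2 : x ∈ E <;>
      simp [h1, h2] at hi ⊢ <;> norm_num at hi
  rw [kernelEnergy_congr_set hEE'] at key
  simp_rw [fun i => kernelEnergy_congr_set (k := K (φ (ψ i))) (hFF' (φ (ψ i)))] at key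
  have hle : liminf (fun i => kernelEnergy (K (φ (ψ i))) (F (φ (ψ i)))) atTop ≤ b := by
    refine liminf_le_of_frequently_le' (Eventually.frequently (Eventually.of_forall fun i => ?_))
    exact (hφb _).le
  exact absurd (key.trans hle) (not_le.2 hb2)

theorem tendsto_kernelEnergy {K : ℕ → EuclideanSpace ℝ (Fin n) → ENNReal}
    (hk : Measurable k) (hK : ∀ i, Measurable (K i))
    (hlim : ∀ z, z ≠ 0 → Tendsto (fun i => K i z) atTop (𝓝 (k z)))
    (hle : ∀ i z, z ≠ 0 → K i z ≤ k z) (hE : NullMeasurableSet E) :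
    Tendsto (fun i => kernelEnergy (K i) E) atTop (𝓝 (kernelEnergy k E)) := by
  obtain ⟨E', -, hE', hEE'⟩ := hE.exists_measurable_superset_ae_eq
  rw [← kernelEnergy_congr_set hEE']
  simp_rw [fun i => (kernelEnergy_congr_set (k := K i) hEE').symm]
  have hmono : ∀ i, kernelEnergy (K i) E' ≤ kernelEnergy k E' := by
    intro i
    refine setLIntegral_mono' hE' fun x hx => setLIntegral_mono' hE'.compl fun y hy => ?_
    refine hle i _ fun h => ?_
    rw [sub_eq_zero] at h
    exact hy (h ▸ hx)
  refine tendsto_of_le_liminf_of_limsup_le ?_ ?_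
  · exact kernelEnergy_le_liminf_of_ae hk hK hlim hE' (fun _ => hE') (by simp)
  · refine limsup_le_of_le (h := Eventually.of_forall hmono)

end

/-! ### Gamma-convergence of the fractional heat energies -/

theorem measurable_fracHeatKernel {n : ℕ} (s t : ℝ) :
    Measurable fun z : EuclideanSpace ℝ (Fin n) => fracHeatKernel s z t := by
  unfold fracHeatKernel
  have h : Measurable fun p : EuclideanSpace ℝ (Fin n) × EuclideanSpace ℝ (Fin n) =>
      Complex.exp (Complex.I * ((inner ℝ p.1 p.2 : ℝ) : ℂ)) *
        ((Real.exp (-t * ‖p.2‖ ^ (2 * s)) : ℝ) : ℂ) := by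
    fun_prop
  exact (Complex.measurable_re.comp
    (h.stronglyMeasurable.integral_prod_right (ν := volume)).measurable).const_mul _

theorem kernelEnergy_const_mul {n : ℕ} {c : ENNReal} (hc : c ≠ ⊤)
    (k : EuclideanSpace ℝ (Fin n) → ENNReal) (E : Set (EuclideanSpace ℝ (Fin n))) :
    kernelEnergy (fun z => c * k z) E = c * kernelEnergy k E := by
  unfold kernelEnergy
  simp_rw [lintegral_const_mul' c _ hc]

theorem fracHeatEnergy_div {n : ℕ} (s : ℝ) {t : ℝ} (ht : 0 < t)
    (E : Set (EuclideanSpace ℝ (Fin n))) :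
    fracHeatEnergy s t E / ENNReal.ofReal t =
      kernelEnergy (fun z => ENNReal.ofReal (fracHeatKernel s z t / t)) E := by
  have h : (fun z : EuclideanSpace ℝ (Fin n) => ENNReal.ofReal (fracHeatKernel s z t / t)) =
      fun z => (ENNReal.ofReal t)⁻¹ * ENNReal.ofReal (fracHeatKernel s z t) := by
    funext z
    rw [ENNReal.ofReal_div_of_pos ht, div_eq_mul_inv, mul_comm]
  rw [h, kernelEnergy_const_mul (ENNReal.inv_ne_top.2 (ENNReal.ofReal_pos.2 ht).ne'), mul_comm]
  rfl

theorem mul_fracPerimeter {n : ℕ} (s : ℝ) {c : ℝ} (hc : 0 ≤ c)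
    (E : Set (EuclideanSpace ℝ (Fin n))) :
    ENNReal.ofReal c * fracPerimeter s E =
      kernelEnergy (fun z => ENNReal.ofReal (c * (1 / ‖z‖ ^ ((n : ℝ) + 2 * s)))) E := by
  simp_rw [ENNReal.ofReal_mul hc]
  rw [kernelEnergy_const_mul ENNReal.ofReal_ne_top]
  rfl

theorem mainTheorem2 (n : ℕ) [NeZero n] (s : ℝ) (hs0 : 0 < s) (hs : s < 1 / 2)
    (t : ℕ → ℝ) (ht : ∀ i, t i ∈ Set.Ioo (0 : ℝ) 1) (ht0 : Tendsto t atTop (𝓝 0)) :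
    -- lower bound
    (∀ E : Set (EuclideanSpace ℝ (Fin n)), NullMeasurableSet E volume →
      ∀ F : ℕ → Set (EuclideanSpace ℝ (Fin n)),
        (∀ i, NullMeasurableSet (F i) volume) → TendstoSetL1 F E →
          ENNReal.ofReal (fracLaplaceConst n s) * fracPerimeter s E ≤
            liminf (fun i => fracHeatEnergy s (t i) (F i) / ENNReal.ofReal (t i)) atTop) ∧
    -- upper bound
    (∀ E : Set (EuclideanSpace ℝ (Fin n)), NullMeasurableSet E volume →
      ∃ F : ℕ → Set (EuclideanSpace ℝ (Fin n)),
        (∀ i, NullMeasurableSet (F i) volume) ∧ TendstoSetL1 F E ∧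
          limsup (fun i => fracHeatEnergy s (t i) (F i) / ENNReal.ofReal (t i)) atTop ≤
            ENNReal.ofReal (fracLaplaceConst n s) * fracPerimeter s E) ∧
    -- the constant sequence is a recovery sequence, with convergence of the energies
    (∀ E : Set (EuclideanSpace ℝ (Fin n)), NullMeasurableSet E volume →
      Tendsto (fun i => fracHeatEnergy s (t i) E / ENNReal.ofReal (t i)) atTop
        (𝓝 (ENNReal.ofReal (fracLaplaceConst n s) * fracPerimeter s E))) := by
  simp_rw [fun i E => fracHeatEnergy_div (n := n) s (ht i).1 E, fracLaplaceConst_eq hs0 hs,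
    mul_fracPerimeter s (rieszConst_pos (n := n) hs0 hs).le]
  have hk : Measurable fun z : EuclideanSpace ℝ (Fin n) =>
      ENNReal.ofReal (rieszConst n s * (1 / ‖z‖ ^ ((n : ℝ) + 2 * s))) := by
    fun_prop
  have hK : ∀ i, Measurable fun z : EuclideanSpace ℝ (Fin n) =>
      ENNReal.ofReal (fracHeatKernel s z (t i) / t i) := fun i =>
    ((measurable_fracHeatKernel s (t i)).div_const _).ennreal_ofReal
  have ht0' : Tendsto t atTop (𝓝[>] 0) :=
    tendsto_nhdsWithin_iff.2 ⟨ht0, Eventually.of_forall fun i => (ht i).1⟩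
  have hlim : ∀ z : EuclideanSpace ℝ (Fin n), z ≠ 0 →
      Tendsto (fun i => ENNReal.ofReal (fracHeatKernel s z (t i) / t i)) atTop
        (𝓝 (ENNReal.ofReal (rieszConst n s * (1 / ‖z‖ ^ ((n : ℝ) + 2 * s))))) := fun z hz =>
    ENNReal.tendsto_ofReal ((tendsto_fracHeatKernel_div hs0 hs hz).comp ht0')
  have hle : ∀ i, ∀ z : EuclideanSpace ℝ (Fin n), z ≠ 0 →
      ENNReal.ofReal (fracHeatKernel s z (t i) / t i) ≤
        ENNReal.ofReal (rieszConst n s * (1 / ‖z‖ ^ ((n : ℝ) + 2 * s))) := fun i z hz =>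
    ENNReal.ofReal_le_ofReal (fracHeatKernel_div_le hs0 hs (ht i).1 hz)
  refine ⟨fun E hE F hF hFE => kernelEnergy_le_liminf hk hK hlim hE hF hFE, fun E hE => ?_,
    fun E hE => tendsto_kernelEnergy hk hK hlim hle hE⟩
  refine ⟨fun _ => E, fun _ => hE, ?_, (tendsto_kernelEnergy hk hK hlim hle hE).limsup_eq.le⟩
  simp [TendstoSetL1]
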